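/- Let $A$ be a real Banach algebra with unit (for instance the $N\times N$ real or complex matrices), let $t\ge 0$ and let $H:[0,t]\to A$ be continuous. Write $\Delta^n_t=\{(t_1,\dots,t_n)\mid 0\le t_1\le\cdots\le t_n\le t\}$ and, for $\sigma\in S_n$, $\Delta^n_{\sigma,t}=\{(t_{\sigma(1)},\dots,t_{\sigma(n)})\mid (t_1,\dots,t_n)\in\Delta^n_t\}$. Put $$X_n(t)=\int_{\Delta^n_t}H(t_1)\cdots H(t_n)\,dt_1\cdots dt_n,\qquad X_\sigma(t)=\int_{\Delta^n_{\sigma,t}}H(u_1)\cdots H(u_n)\,du_1\cdots du_n,$$ and $X_n(t)\cdot x=\sum_{\beta\in S_n}x_\beta X_\beta(t)$ for $x=\sum_\beta x_\beta\,\beta\in\mathbb Q[S_n]$. Identify $\beta\in S_n$ with the word $\beta(1)\cdots\beta(n)$, let $[w,w']=ww'-w'w$ for words, and set $$[X]_\sigma(t)=X_n(t)\cdot[\sigma(1),[\sigma(2),[\cdots[\sigma(n-1),\sigma(n)]\cdots]]].$$ For $\sigma\in S_{n-1}$ let $\sigma^+=(\sigma(1),\dots,\sigma(n-1),n)\in S_n$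 and $\mathrm{Desc}(\sigma)=\{i\mid 1\le i<n-1,\ \sigma(i)>\sigma(i+1)\}$. For $n\ge1$ put $$\Omega_n(t)=\sum_{\sigma\in S_{n-1}}\frac{(-1)^{|\mathrm{Desc}(\sigma)|}}{n}\binom{n-1}{|\mathrm{Desc}(\sigma)|}^{-1}[X]_{\sigma^+}(t).$$ Then $\Omega(t)=\log X(t)$ equals $\sum_{n\ge1}\Omega_n(t)$, in the following two senses. 1. As formal series graded by the number of factors $H$: in $A[[\lambda]]$, $$\log\Big(\sum_{n\ge0}\lambda^nX_n(t)\Big)=\sum_{n\ge1}\lambda^n\,\Omega_n(t),\qquad\text{where }\log f=\sum_{k\ge1}\frac{(-1)^{k+1}}{k}(f-1)^k .$$ 2. As convergent series: if $X:[0,t]\to A$ solves $\dot X(s)=X(s)H(s)$, $X(0)=1$, then $X(t)=\sum_{n\ge0}X_n(t)$; and if moreover $\int_0^t\|H(s)\|\,ds<\log 2$, then the series $\sum_{k\ge1}\frac{(-1)^{k+1}}{k}(X(t)-1)^k$ and $\sum_{n\ge1}\Omega_n(t)$ both converge (unconditionally), to the same element $\Omega(t)=\log X(t)$. -/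

import Mathlib

noncomputable section

open MeasureTheory

namespace IteratedIntegral

/-! Permutations of `{1, …, n}` are modelled by `Equiv.Perm (Fin n)`, and identified with the words
`σ(1) ⋯ σ(n)`. -/

/-- The descent set `{i | 1 ≤ i < n, σ(i) > σ(i+1)}` of a permutation. -/
def descents {n : ℕ} (σ : Equiv.Perm (Fin n)) : Finset (Fin n) :=
  Finset.univ.filter fun i => ∃ h : (i : ℕ) + 1 < n, σ ⟨(i : ℕ) + 1, h⟩ < σ i

/-- For `σ ∈ S_m`, the permutation `σ⁺ = (σ(1), …, σ(m), m + 1) ∈ S_{m+1}`. -/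
def plus {m : ℕ} (σ : Equiv.Perm (Fin m)) : Equiv.Perm (Fin (m + 1)) :=
  (finSuccEquivLast.trans (Equiv.optionCongr σ)).trans finSuccEquivLast.symm

@[simp] theorem plus_castSucc {m : ℕ} (σ : Equiv.Perm (Fin m)) (i : Fin m) :
    plus σ i.castSucc = (σ i).castSucc := by
  simp [plus]

@[simp] theorem plus_last {m : ℕ} (σ : Equiv.Perm (Fin m)) :
    plus σ (Fin.last m) = Fin.last m := by
  simp [plus]

/-- The rational linear combinations of words on the letters `1, …, n`, with concatenation. -/
abbrev Words (n : ℕ) : Type := MonoidAlgebra ℚ (FreeMonoid (Fin n))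

/-- A letter, as a one-letter word. -/
def letter {n : ℕ} (i : Fin n) : Words n := MonoidAlgebra.of ℚ _ (FreeMonoid.of i)

/-- The right-nested commutator `[a₁, [a₂, [⋯ [aₖ₋₁, aₖ] ⋯]]]` of a nonempty list of letters, where
`[w, w'] = w w' - w' w` (the value on the empty list is irrelevant). -/
def nestedWord {n : ℕ} : List (Fin n) → Words n
  | [] => 0
  | [a] => letter a
  | a :: b :: l => letter a * nestedWord (b :: l) - nestedWord (b :: l) * letter a

/-- The element `[σ(1), [σ(2), [⋯ [σ(n-1), σ(n)] ⋯]]]` of `ℚ[S_n]`, given by its coefficients: the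
coefficient at `β` is the coefficient of the word `β(1) ⋯ β(n)`. -/
def nestedBracket {n : ℕ} (σ : Equiv.Perm (Fin n)) : Equiv.Perm (Fin n) → ℚ := fun β =>
  (nestedWord (List.ofFn σ)).coeff (FreeMonoid.ofList (List.ofFn β))

/-- The standard simplex `{(t₁, …, tₙ) | 0 ≤ t₁ ≤ ⋯ ≤ tₙ ≤ t}`. -/
def orderedSimplex (n : ℕ) (t : ℝ) : Set (Fin n → ℝ) :=
  {s | Monotone s ∧ ∀ i, 0 ≤ s i ∧ s i ≤ t}

/-- The simplex `{(t_{σ(1)}, …, t_{σ(n)}) | 0 ≤ t₁ ≤ ⋯ ≤ tₙ ≤ t}`. -/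
def permSimplex {n : ℕ} (σ : Equiv.Perm (Fin n)) (t : ℝ) : Set (Fin n → ℝ) :=
  (fun s i => s (σ i)) '' orderedSimplex n t

variable {A : Type*} [NormedRing A] [NormedAlgebra ℝ A]

/-- The iterated integral `X_σ(t) = ∫_{Δ_{σ,t}} H(u₁) ⋯ H(uₙ) du₁ ⋯ duₙ`. -/
def permIntegral (H : ℝ → A) (t : ℝ) {n : ℕ} (σ : Equiv.Perm (Fin n)) : A :=
  ∫ u in permSimplex σ t, (List.ofFn fun i => H (u i)).prod

/-- `Xₙ(t) · x = ∑_β x_β X_β(t)` for `x = ∑_β x_β β ∈ ℚ[S_n]`. -/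
def permAction (H : ℝ → A) (t : ℝ) {n : ℕ} (x : Equiv.Perm (Fin n) → ℚ) : A :=
  ∑ β, ((x β : ℚ) : ℝ) • permIntegral H t β

/-- `[X]_σ(t) = Xₙ(t) · [σ(1), [σ(2), [⋯ [σ(n-1), σ(n)] ⋯]]]`. -/
def bracketIntegral (H : ℝ → A) (t : ℝ) {n : ℕ} (σ : Equiv.Perm (Fin n)) : A :=
  permAction H t (nestedBracket σ)

/-- The Dyson term `Xₙ(t)`, the integral of `H(t₁) ⋯ H(tₙ)` over the standard simplex. -/
def dysonTerm (H : ℝ → A) (t : ℝ) (n : ℕ) : A :=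
  ∫ s in orderedSimplex n t, (List.ofFn fun i => H (s i)).prod

/-- The Dyson series `∑ₙ λⁿ Xₙ(t)`; the formal parameter `λ` counts the factors `H`. -/
def dysonSeries (H : ℝ → A) (t : ℝ) : PowerSeries A :=
  PowerSeries.mk (dysonTerm H t)

/-- The formal logarithm `∑_{k ≥ 1} (-1)^{k+1}/k (f - 1)^k` of a power series `f` with constant
coefficient `1` (over a possibly noncommutative algebra); since `(f - 1)^k` is divisible by `λ^k`,
only the `k ≤ n` contribute to the coefficient of `λⁿ`. -/
def formalLog (f : PowerSeries A) : PowerSeries A :=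
  PowerSeries.mk fun n =>
    ∑ k ∈ Finset.Icc 1 n, ((-1 : ℝ) ^ (k + 1) / (k : ℝ)) • PowerSeries.coeff n ((f - 1) ^ k)

/-- The degree `n` term of the right-hand side of the nested commutator expansion:
`∑_{σ ∈ S_{n-1}} (-1)^{|Desc σ|} / n · (n-1 choose |Desc σ|)⁻¹ [X]_{σ⁺}(t)` for `n ≥ 1`, and `0` for
`n = 0`. -/
def nestedTerm (H : ℝ → A) (t : ℝ) : ℕ → A
  | 0 => 0
  | m + 1 => ∑ σ : Equiv.Perm (Fin m),
      ((-1 : ℝ) ^ (descents σ).card / ((m + 1 : ℕ) : ℝ) *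
        ((m.choose (descents σ).card : ℕ) : ℝ)⁻¹) • bracketIntegral H t (plus σ)

end IteratedIntegral

end

/-! Up to a null set the cube `[0,t]ⁿ` is the disjoint union of the permuted simplices. By Fubini,
the degree `n` part of `(f - 1)^k`, for `f` the Dyson series, is the integral over the cube of
`H(u₁) ⋯ H(uₙ)` weighted by the number of ways to cut the word `u` into `k` nonempty increasing
pieces (`integral_cuts_smul_mapProd`). This number depends only on the relative order of the `uᵢ`.
Summing over `k` with the weights of the logarithm is a Beta integral, so the logarithm has degree
`n` part `∑_τ c(τ) X_τ`, with `c(τ) = (-1)^des asc! des! / n!` (`sum_Icc_mul_cuts`).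

It remains to rewrite this sum with the nested commutators ending in the largest letter `z`. The
coefficient of `u z v` in `[a₁, [⋯ [aₖ, z]]]` is `(-1)^|v|` times the number of ways `a₁ ⋯ aₖ`
arises as a shuffle of `u` and reversed `v` (`sum_mul_coeff_nestedWord`). Hence `c(u z v)` must
equal `(-1)^|v|` times the sum of `c(r z)` over these shuffles `r` (`logCoeff_append_max`). To see
this, view `c(w)` as the linear coefficient in `m` of `binom(m + asc w, |w|)`, the coefficient of
`w` in the `m`-th power of the series of increasing words. Locating `z` turns this polynomial into a
convolution. Taking linear coefficients replaces `m - j` by `-j`, reciprocity reverses `v` at the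
cost of a sign, and the remaining product of two counts is a sum over shuffles.

For convergence, the Dyson terms are dominated by those of `exp(∫‖H‖)`. The double series of the
logarithm then converges absolutely as soon as `exp(∫‖H‖) - 1 < 1`. -/

noncomputable section

open MeasureTheory

namespace IteratedIntegral

/-! ### Ascents, descents and shuffles of words -/

section Words

variable {α : Type*} [LinearOrder α]

/-- The number of ascents of a word. -/
def asc : List α → ℕ
  | [] => 0
  | [_] => 0
  | a :: b :: l => (if a < b then 1 else 0) + asc (b :: l)

/-- The number of consecutive pairs of letters of a word which are not ascents. -/
def des : List α → ℕ
  | [] => 0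
  | [_] => 0
  | a :: b :: l => (if a < b then 0 else 1) + des (b :: l)

theorem asc_add_des (a : α) (l : List α) : asc (a :: l) + des (a :: l) = l.length := by
  induction l generalizing a with
  | nil => rfl
  | cons b l ih =>
    have := ih b
    simp only [asc, des, List.length_cons]
    split_ifs <;> omega

theorem asc_append_cons (l : List α) (b : α) (l' : List α) :
    asc (l ++ b :: l') = asc (l ++ [b]) + asc (b :: l') := by
  induction l with
  | nil => simp [asc]
  | cons a l ih =>
    cases l with
    | nil => simp [asc]
    | cons c l => simp only [List.cons_append, asc] at ih ⊢; omega

/-- Without repeated letters every non-ascent is a strict descent, which reversal turns into an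
ascent. -/
theorem asc_reverse {l : List α} (hl : l.Nodup) : asc l.reverse = des l := by
  induction l with
  | nil => rfl
  | cons a l ih =>
    cases l with
    | nil => rfl
    | cons b l =>
      have h := ih hl.of_cons
      have hab : a ≠ b := by rintro rfl; simp at hl
      simp only [List.reverse_cons, List.append_assoc, List.cons_append, List.nil_append] at h ⊢
      rw [asc_append_cons, h]
      simp only [asc, des]
      rcases lt_or_gt_of_ne hab with h' | h'
      · simp [h', h'.le]
      · simp [h', not_lt.2 h'.le]; omega

theorem asc_append_max {z : α} {l : List α} (hz : ∀ x ∈ l, x < z) (hl : l ≠ []) :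
    asc (l ++ [z]) = asc l + 1 := by
  induction l with
  | nil => exact absurd rfl hl
  | cons a l ih =>
    cases l with
    | nil => simp [asc, hz a (by simp)]
    | cons b l =>
      have := ih (fun x hx => hz x (by simp_all)) (by simp)
      simp only [List.cons_append, asc] at this ⊢
      omega

theorem des_append_max {z : α} {l : List α} (hz : ∀ x ∈ l, x < z) :
    des (l ++ [z]) = des l := by
  induction l with
  | nil => rfl
  | cons a l ih =>
    cases l with
    | nil => simp [des, hz a (by simp)]
    | cons b l =>
      have := ih (fun x hx => hz x (by simp_all))
      simp only [List.cons_append, des] at this ⊢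
      omega

theorem asc_cons_max {z : α} {l : List α} (hz : ∀ x ∈ l, x < z) : asc (z :: l) = asc l := by
  cases l with
  | nil => rfl
  | cons a l => simp [asc, not_lt.2 (hz a (by simp)).le]

/-- The sum of `f` over all shuffles of two words. -/
def sh {α M : Type*} [AddCommMonoid M] (f : List α → M) : List α → List α → M
  | [], v => f v
  | a :: u, [] => f (a :: u)
  | a :: u, b :: v => sh (fun r => f (a :: r)) u (b :: v) + sh (fun r => f (b :: r)) (a :: u) v
termination_by u v => u.length + v.length

@[simp] theorem sh_nil_left {α M : Type*} [AddCommMonoid M] (f : List α → M) (v : List α) :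
    sh f [] v = f v := by rw [sh]

@[simp] theorem sh_nil_right {α M : Type*} [AddCommMonoid M] (f : List α → M) (u : List α) :
    sh f u [] = f u := by cases u <;> rw [sh]

theorem sh_cons_cons {α M : Type*} [AddCommMonoid M] (f : List α → M) (a b : α) (u v : List α) :
    sh f (a :: u) (b :: v) =
      sh (fun r => f (a :: r)) u (b :: v) + sh (fun r => f (b :: r)) (a :: u) v := by
  rw [sh]

/-- An induction principle following the recursion of `sh`. -/
theorem shuffle_induction {α : Type*} {p : List α → List α → Prop} (left : ∀ v, p [] v)
    (right : ∀ u, p u [])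
    (cons : ∀ a u b v, p u (b :: v) → p (a :: u) v → p (a :: u) (b :: v)) (u v : List α) :
    p u v := by
  induction u generalizing v with
  | nil => exact left v
  | cons a u ihu =>
    induction v with
    | nil => exact right _
    | cons b v ihv => exact cons a u b v (ihu _) ihv

theorem map_sh {α M N : Type*} [AddCommMonoid M] [AddCommMonoid N] (φ : M →+ N)
    (f : List α → M) (u v : List α) : φ (sh f u v) = sh (fun r => φ (f r)) u v := by
  induction u, v using shuffle_induction generalizing f with
  | left v => simp
  | right u => simp
  | cons a u b v h₁ h₂ => rw [sh_cons_cons, sh_cons_cons, map_add, h₁, h₂]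

theorem sh_congr {α M : Type*} [AddCommMonoid M] {f g : List α → M} {u v : List α}
    (h : ∀ r, (∀ x ∈ r, x ∈ u ∨ x ∈ v) → f r = g r) : sh f u v = sh g u v := by
  induction u, v using shuffle_induction generalizing f g with
  | left v => simpa using h v (by simp)
  | right u => simpa using h u (by simp)
  | cons a u b v h₁ h₂ =>
    rw [sh_cons_cons, sh_cons_cons]
    congr 1
    · exact h₁ fun r hr => h _ fun x hx => by
        have := hr x
        grind
    · exact h₂ fun r hr => h _ fun x hx => by
        have := hr x
        grind

theorem sh_sum {α ι M : Type*} [AddCommMonoid M] (s : Finset ι) (f : ι → List α → M)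
    (u v : List α) : sh (fun r => ∑ i ∈ s, f i r) u v = ∑ i ∈ s, sh (f i) u v := by
  induction u, v using shuffle_induction generalizing f with
  | left v => simp
  | right u => simp
  | cons a u b v h₁ h₂ => simp only [sh_cons_cons, h₁, h₂, Finset.sum_add_distrib]

/-! ### Counting labellings of words -/

/-- The number of labels which may follow the label `j` when the letter `b` follows `a`. -/
def labelBound (j : ℕ) (a b : α) : ℕ := if a < b then j + 1 else j

/-- The number of labellings of a word by natural numbers, weakly decreasing and strictly
decreasing at non-ascents, whose first label is `j`. -/
def labelCount : ℕ → List α → ℝ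
  | _, [] => 1
  | _, [_] => 1
  | j, a :: b :: l => ∑ i ∈ Finset.range (labelBound j a b), labelCount i (b :: l)

theorem sum_labelBound {j N : ℕ} (a b : α) (hN : j < N) (f : ℕ → ℝ) :
    ∑ i ∈ Finset.range (labelBound j a b), f i =
      ∑ i ∈ Finset.range N, if i < labelBound j a b then f i else 0 := by
  rw [← Finset.sum_filter]
  congr 1
  ext i
  have : labelBound j a b ≤ N := by unfold labelBound; split_ifs <;> omega
  simp only [Finset.mem_range, Finset.mem_filter]
  omega

theorem sum_labelBound_mul_sum_labelBound (m : ℕ) (a : α) {b c : α} (hbc : b ≠ c) (f g : ℕ → ℝ) :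
    ∑ i ∈ Finset.range (labelBound m a b),
        f i * ∑ k ∈ Finset.range (labelBound i b c), g k +
      ∑ k ∈ Finset.range (labelBound m a c),
        (∑ i ∈ Finset.range (labelBound k c b), f i) * g k =
    (∑ i ∈ Finset.range (labelBound m a b), f i) *
      ∑ k ∈ Finset.range (labelBound m a c), g k := by
  have e : ∀ i ∈ Finset.range (m + 1), ∀ (x y : α) (f : ℕ → ℝ),
      ∑ k ∈ Finset.range (labelBound i x y), f k =
        ∑ k ∈ Finset.range (m + 1), if k < labelBound i x y then f k else 0 :=
    fun i hi x y f => sum_labelBound x y (Finset.mem_range.1 hi) f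
  simp only [e m (by simp)]
  have h₁ : ∀ i ∈ Finset.range (m + 1), (if i < labelBound m a b then
      f i * ∑ k ∈ Finset.range (labelBound i b c), g k else 0) = ∑ k ∈ Finset.range (m + 1),
        if i < labelBound m a b ∧ k < labelBound i b c then f i * g k else 0 := by
    intro i hi
    rw [e i hi, Finset.mul_sum]
    split_ifs with h <;> simp [h]
  have h₂ : ∀ k ∈ Finset.range (m + 1), (if k < labelBound m a c then
      (∑ i ∈ Finset.range (labelBound k c b), f i) * g k else 0) = ∑ i ∈ Finset.range (m + 1),
        if k < labelBound m a c ∧ i < labelBound k c b then f i * g k else 0 := by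
    intro k hk
    rw [e k hk, Finset.sum_mul]
    split_ifs with h <;> simp [h]
  rw [Finset.sum_congr rfl h₁, Finset.sum_congr rfl h₂, add_comm, Finset.sum_comm, add_comm,
    Finset.sum_mul_sum, ← Finset.sum_add_distrib]
  refine Finset.sum_congr rfl fun i _ => ?_
  rw [← Finset.sum_add_distrib]
  refine Finset.sum_congr rfl fun k _ => ?_
  -- If both labels `i` of `b` and `k` of `c` may follow `m`, exactly one order of the two letters
  -- is admissible: the larger label comes first, and a tie is decided by comparing `b` with `c`.
  -- Otherwise neither order is.
  have key : ((i < labelBound m a b ∧ k < labelBound i b c) ∧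
        ¬ (k < labelBound m a c ∧ i < labelBound k c b) ∧
        i < labelBound m a b ∧ k < labelBound m a c) ∨
      (¬ (i < labelBound m a b ∧ k < labelBound i b c) ∧
        (k < labelBound m a c ∧ i < labelBound k c b) ∧
        i < labelBound m a b ∧ k < labelBound m a c) ∨
      (¬ (i < labelBound m a b ∧ k < labelBound i b c) ∧
        ¬ (k < labelBound m a c ∧ i < labelBound k c b) ∧
        ¬ (i < labelBound m a b ∧ k < labelBound m a c)) := by
    unfold labelBound
    rcases lt_or_gt_of_ne hbc with h | h
    · by_cases hab : a < b
      · have := hab.trans h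
        simp only [h, h.not_gt, hab, this, if_true, if_false]
        omega
      · simp only [h, h.not_gt, hab, if_true, if_false]
        split_ifs <;> omega
    · by_cases hac : a < c
      · have := hac.trans h
        simp only [h, h.not_gt, hac, this, if_true, if_false]
        omega
      · simp only [h, h.not_gt, hac, if_true, if_false]
        split_ifs <;> omega
  rw [ite_zero_mul_ite_zero]
  rcases key with ⟨h, h', h''⟩ | ⟨h, h', h''⟩ | ⟨h, h', h''⟩
  · rw [if_pos h, if_neg h', if_pos h'', add_zero]
  · rw [if_neg h, if_pos h', if_pos h'', zero_add]
  · rw [if_neg h, if_neg h', if_neg h'', zero_add]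

/-- Labellings of a shuffle of two words are pairs of labellings of the words. -/
theorem sh_labelCount (m : ℕ) (a : α) (u v : List α) (huv : ∀ x ∈ u, x ∉ v) :
    sh (fun r => labelCount m (a :: r)) u v = labelCount m (a :: u) * labelCount m (a :: v) := by
  induction u, v using shuffle_induction generalizing m a with
  | left v => simp [labelCount]
  | right u => simp [labelCount]
  | cons b u c v h₁ h₂ =>
    have hbc : b ≠ c := by rintro rfl; simpa using huv b
    rw [sh_cons_cons]
    simp only [labelCount]
    -- Once the first letter of the shuffle and its label are fixed, the induction hypothesis splits
    -- the rest into a product.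
    rw [sh_sum, sh_sum, Finset.sum_congr rfl fun i _ => h₁ i b fun x hx => huv x (by simp [hx]),
      Finset.sum_congr rfl fun i _ => h₂ i c fun x hx hv => huv x hx (by simp [hv])]
    exact sum_labelBound_mul_sum_labelBound m a hbc (fun i => labelCount i (b :: u))
      fun k => labelCount k (c :: v)

end Words

/-! ### Convolutions of binomial coefficients -/

theorem sum_antidiagonal_choose_mul_choose (m p q : ℕ) :
    ∑ x ∈ Finset.HasAntidiagonal.antidiagonal m, x.1.choose p * x.2.choose q = (m + 1).choose (p + q + 1) := by
  induction m generalizing p with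
  | zero => 
    cases p <;> cases q <;> simp [Nat.choose_eq_zero_of_lt]
  | succ m ih =>
    cases p with
    | zero =>
      simp only [Nat.choose_zero_right, one_mul, zero_add]
      rw [Finset.Nat.antidiagonal_succ, Finset.sum_cons, Finset.sum_map]
      have := ih 0
      simp only [Nat.choose_zero_right, one_mul, zero_add] at this
      simp only [Function.Embedding.prodMap, Function.Embedding.coeFn_mk, Prod.map,
        Function.Embedding.refl_apply]
      rw [this, Nat.choose_succ_succ (m + 1)]
    | succ p =>
      rw [Finset.Nat.antidiagonal_succ, Finset.sum_cons, Finset.sum_map]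
      simp only [Function.Embedding.prodMap, Function.Embedding.coeFn_mk, Prod.map,
        Function.Embedding.refl_apply, Nat.succ_eq_add_one, Nat.choose_succ_succ' _ p, add_mul,
        Finset.sum_add_distrib, Nat.choose_zero_succ, zero_mul, zero_add]
      rw [ih, ih, show p + 1 + q + 1 = p + q + 1 + 1 by ring, Nat.choose_succ_succ' (m + 1)]

theorem sum_antidiagonal_add_choose_mul_add_choose (m e₁ d₁ e₂ d₂ : ℕ) :
    ∑ x ∈ Finset.HasAntidiagonal.antidiagonal m,
        (x.1 + e₁).choose (e₁ + d₁) * (x.2 + e₂).choose (e₂ + d₂) =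
      (m + e₁ + e₂ + 1).choose (e₁ + e₂ + d₁ + d₂ + 1) := by
  induction e₁ generalizing m d₁ with
  | zero =>
    induction e₂ generalizing m d₂ with
    | zero => simpa using sum_antidiagonal_choose_mul_choose m d₁ d₂
    | succ e₂ ih =>
      -- Raising `m` and `d₂` together shifts the second index by one; the extra endpoint term
      -- contains `binom(e₂, e₂ + d₂ + 1) = 0`.
      have := ih (d₂ := d₂ + 1) (m := m + 1)
      rw [Finset.Nat.antidiagonal_succ', Finset.sum_cons, Finset.sum_map] at this
      simp only [Function.Embedding.prodMap, Function.Embedding.coeFn_mk, Prod.map,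
        Function.Embedding.refl_apply, Nat.succ_eq_add_one] at this
      rw [Nat.choose_eq_zero_of_lt (by omega : 0 + e₂ < e₂ + (d₂ + 1)), mul_zero, zero_add] at this
      simp only [add_assoc, add_comm, add_left_comm] at this ⊢
      exact this
  | succ e₁ ih =>
    have := ih (m + 1) (d₁ + 1)
    rw [Finset.Nat.antidiagonal_succ, Finset.sum_cons, Finset.sum_map] at this
    simp only [Function.Embedding.prodMap, Function.Embedding.coeFn_mk, Prod.map,
      Function.Embedding.refl_apply, Nat.succ_eq_add_one] at this
    rw [Nat.choose_eq_zero_of_lt (by omega : 0 + e₁ < e₁ + (d₁ + 1)), zero_mul, zero_add] at this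
    simp only [add_assoc, add_comm, add_left_comm] at this ⊢
    exact this

/-- The recursion is hockey-stick summation; an ascent raises the upper limit of the sum by one. -/
theorem labelCount_cons {α : Type*} [LinearOrder α] (j : ℕ) (a : α) (l : List α) :
    labelCount j (a :: l) = (j + asc (a :: l)).choose l.length := by
  induction l generalizing j a with
  | nil => simp [labelCount]
  | cons b l ih =>
    simp only [labelCount, ih]
    have h₀ := asc_add_des b l
    have key : ∀ N, ∑ i ∈ Finset.range N, (i + asc (b :: l)).choose l.length =
        (N + asc (b :: l)).choose (l.length + 1) := by
      intro N
      induction N with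
      | zero => simp; rw [Nat.choose_eq_zero_of_lt]; omega
      | succ N ihN =>
        rw [Finset.sum_range_succ, ihN, add_right_comm, Nat.choose_succ_succ' _ l.length, add_comm]
    rw [← Nat.cast_sum, key]
    congr 2
    unfold labelBound
    simp only [asc]
    split_ifs <;> omega

/-! ### Label-counting polynomials and their linear coefficients -/

section Polynomials

open Polynomial

/-- The polynomial `binom(x + e, k)`. -/
def choosePoly (e k : ℕ) : ℝ[X] :=
  C ((k.factorial : ℝ)⁻¹) * (descPochhammer ℝ k).comp (X + C (e : ℝ))

theorem eval_choosePoly (e k : ℕ) (x : ℝ) :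
    (choosePoly e k).eval x = (k.factorial : ℝ)⁻¹ * ∏ i ∈ Finset.range k, (x + e - i) := by
  simp [choosePoly, descPochhammer_eval_eq_prod_range]

theorem eval_natCast_choosePoly (e k j : ℕ) :
    (choosePoly e k).eval (j : ℝ) = ((j + e).choose k : ℕ) := by
  have : (k.factorial : ℝ) ≠ 0 := by positivity
  rw [choosePoly, eval_mul, eval_C, eval_comp, eval_add, eval_X, eval_C, ← Nat.cast_add,
    descPochhammer_eval_eq_descFactorial, Nat.descFactorial_eq_factorial_mul_choose]
  push_cast
  field_simp

/-- The substitution `x ↦ -x` exchanges the roots `-e, …, e'` with `-e', …, e`. -/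
theorem eval_neg_choosePoly {e e' k : ℕ} (h : e + e' + 1 = k) (x : ℝ) :
    (choosePoly e k).eval (-x) = (-1) ^ k * (choosePoly e' k).eval x := by
  rw [eval_choosePoly, eval_choosePoly, mul_left_comm]
  congr 1
  rw [← Finset.prod_range_reflect, ← Finset.card_range k, ← Finset.prod_const, Finset.card_range,
    ← Finset.prod_mul_distrib]
  refine Finset.prod_congr rfl fun i hi => ?_
  have hi := Finset.mem_range.1 hi
  have : ((k - 1 - i : ℕ) : ℝ) = e + e' - i := by
    rw [show k - 1 - i = e + e' - i by omega, Nat.cast_sub (by omega)]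
    push_cast; ring
  rw [this]
  ring

/-- Divide `(x + e) ⋯ (x + 1) x (x - 1) ⋯ (x - d)` by `x` and evaluate at `0`. -/
theorem coeff_one_choosePoly (e d : ℕ) :
    (choosePoly e (e + d + 1)).coeff 1 =
      (-1) ^ d * (e.factorial * d.factorial / (e + d + 1).factorial) := by
  have h : choosePoly e (e + d + 1) = C (((e + d + 1).factorial : ℝ)⁻¹) *
      (X * ((∏ i ∈ Finset.range e, (X + C ((e : ℝ) - i))) *
        ∏ i ∈ Finset.range d, (X - C ((i : ℝ) + 1)))) := by
    refine Polynomial.funext fun x => ?_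
    rw [eval_choosePoly, add_assoc, Finset.prod_range_add, Finset.prod_range_succ' _ d]
    simp only [eval_mul, eval_C, eval_X, eval_prod, eval_add, eval_sub]
    congr 1
    rw [mul_comm (∏ i ∈ Finset.range d, _), mul_left_comm]
    congr 1
    · simp
    · congr 1
      · exact Finset.prod_congr rfl fun i _ => by ring
      · exact Finset.prod_congr rfl fun i _ => by push_cast; ring
  rw [h, coeff_C_mul, coeff_X_mul, coeff_zero_eq_eval_zero]
  simp only [eval_mul, eval_C, eval_X, eval_prod, eval_add, eval_sub, zero_add, zero_sub]
  have h₁ : ∏ i ∈ Finset.range e, ((e : ℝ) - i) = e.factorial := by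
    rw [← Finset.prod_range_reflect, ← Finset.prod_range_add_one_eq_factorial]
    push_cast
    refine Finset.prod_congr rfl fun i hi => ?_
    have hi := Finset.mem_range.1 hi
    rw [show e - 1 - i = e - (i + 1) by omega, Nat.cast_sub (by omega)]
    push_cast; ring
  have h₂ : ∏ i ∈ Finset.range d, (-((i : ℝ) + 1)) = (-1) ^ d * d.factorial := by
    rw [Finset.prod_neg, Finset.card_range, ← Finset.prod_range_add_one_eq_factorial]
    push_cast; rfl
  rw [h₁, h₂]
  ring

/-- Faulhaber's formula. The vanishing constant term is what isolates the linear coefficient of a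
convolution in `coeff_one_convolution`. -/
theorem exists_sum_polynomial (p : ℝ[X]) : ∃ S : ℝ[X], S.coeff 0 = 0 ∧
    ∀ m : ℕ, S.eval (m : ℝ) = ∑ j ∈ Finset.range m, p.eval ((j : ℝ) + 1) := by
  induction p using Polynomial.induction_on' with
  | add p q hp hq =>
    obtain ⟨S, hS₀, hS⟩ := hp
    obtain ⟨T, hT₀, hT⟩ := hq
    exact ⟨S + T, by simp [hS₀, hT₀], fun m => by simp [hS, hT, Finset.sum_add_distrib]⟩
  | monomial k a =>
    refine ⟨∑ i ∈ Finset.range (k + 1),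
      C (a * ((bernoulli' i * (k + 1).choose i / (k + 1) : ℚ) : ℝ)) * X ^ (k + 1 - i), ?_, ?_⟩
    · rw [finsetSum_coeff]
      refine Finset.sum_eq_zero fun i hi => ?_
      have := Finset.mem_range.1 hi
      rw [coeff_C_mul, coeff_X_pow, if_neg (by omega), mul_zero]
    · intro m
      have h := congrArg (fun x : ℚ => (x : ℝ)) (sum_Ico_pow m k)
      simp only [Finset.sum_Ico_eq_sum_range, Nat.add_sub_cancel] at h
      push_cast at h
      simp only [eval_monomial, ← Finset.mul_sum, add_comm _ (1 : ℝ)]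
      rw [h, eval_finsetSum, Finset.mul_sum]
      refine Finset.sum_congr rfl fun i _ => ?_
      simp only [eval_mul, eval_C, eval_pow, eval_X]
      push_cast
      ring

theorem eq_of_eval_natCast {p q : ℝ[X]} (h : ∀ m : ℕ, p.eval (m : ℝ) = q.eval (m : ℝ)) : p = q := by
  refine Polynomial.eq_of_infinite_eval_eq p q ((Set.infinite_range_of_injective
    (Nat.cast_injective (R := ℝ))).mono ?_)
  rintro _ ⟨m, rfl⟩
  exact h m

/-- The linear coefficient of `∑_{j=1}^m f(j) g(m-j)` as a polynomial in `m` is that of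
`∑_{j=1}^m f(j) g(-j)`. -/
theorem coeff_one_convolution {f g P R : ℝ[X]}
    (hP : ∀ m : ℕ, P.eval (m : ℝ) =
      ∑ j ∈ Finset.range m, f.eval ((j : ℝ) + 1) * g.eval ((m : ℝ) - (j + 1)))
    (hR : ∀ m : ℕ, R.eval (m : ℝ) =
      ∑ j ∈ Finset.range m, f.eval ((j : ℝ) + 1) * g.eval (-((j : ℝ) + 1))) :
    P.coeff 1 = R.coeff 1 := by
  -- Expanding `g(m - j)` around `-j` in powers of `m` gives `P = ∑ Xⁱ Sᵢ`. Since `Sᵢ(0) = 0`, only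
  -- `S₀` contributes in degree one.
  choose S hS₀ hS using fun i : ℕ => exists_sum_polynomial (f * (hasseDeriv i g).comp (-X))
  have hP' : P = ∑ i ∈ Finset.range (g.natDegree + 1), X ^ i * S i := by
    refine eq_of_eval_natCast fun m => ?_
    simp only [hP, eval_finsetSum, eval_mul, eval_pow, eval_X, hS, eval_comp, eval_neg,
      Finset.mul_sum]
    rw [Finset.sum_comm]
    refine Finset.sum_congr rfl fun j _ => ?_
    rw [sub_eq_add_neg, ← taylor_eval _ g, eval_eq_sum_range (p := taylor _ g), natDegree_taylor,
      Finset.mul_sum]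
    refine Finset.sum_congr rfl fun i _ => ?_
    rw [taylor_coeff]
    ring
  have hR' : R = S 0 := by
    refine eq_of_eval_natCast fun m => ?_
    rw [hR, hS]
    exact Finset.sum_congr rfl fun j _ => by simp
  rw [hP', hR', finsetSum_coeff, Finset.sum_range_succ', pow_zero, one_mul]
  convert zero_add _
  refine Finset.sum_eq_zero fun i _ => ?_
  rw [pow_succ, mul_assoc, mul_left_comm, coeff_X_mul]
  simp [mul_coeff_zero, hS₀]

/-- The polynomial in `m` counting the labellings of a word by labels less than `m`. -/
def labelPoly {α : Type*} [LinearOrder α] (w : List α) : ℝ[X] :=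
  choosePoly (asc w) w.length

/-- The coefficient of a word in the logarithm of the generating series of increasing words. -/
def logCoeff {α : Type*} [LinearOrder α] (w : List α) : ℝ := (labelPoly w).coeff 1

variable {α : Type*} [LinearOrder α]

theorem logCoeff_eq {w : List α} (hw : w ≠ []) :
    logCoeff w = (-1) ^ des w *
      ((asc w).factorial * (des w).factorial / w.length.factorial) := by
  cases w with
  | nil => exact absurd rfl hw
  | cons a l =>
    have h := asc_add_des a l
    rw [logCoeff, labelPoly, List.length_cons, ← h, coeff_one_choosePoly]

/-- Cut the word into `m` possibly empty increasing pieces. The largest letter `z` ends its piece;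
if this is piece number `j + 1`, then `u` fills `j + 1` pieces and `v` the remaining `m - (j + 1)`.
The computation is the binomial convolution above. -/
theorem eval_labelPoly_append_max {z : α} {u v : List α} (hu : ∀ x ∈ u, x < z)
    (hv : ∀ x ∈ v, x < z) (m : ℕ) :
    (labelPoly (u ++ z :: v)).eval (m : ℝ) = ∑ j ∈ Finset.range m,
      (labelPoly u).eval ((j : ℝ) + 1) * (labelPoly v).eval ((m : ℝ) - (j + 1)) := by
  have hr : ∀ j ∈ Finset.range m,
      (labelPoly u).eval ((j : ℝ) + 1) * (labelPoly v).eval ((m : ℝ) - (j + 1)) =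
        (((j + 1 + asc u).choose u.length * (m - (j + 1) + asc v).choose v.length : ℕ) : ℝ) := by
    intro j hj
    have hj := Finset.mem_range.1 hj
    rw [← Nat.cast_add_one, ← Nat.cast_sub (by omega), labelPoly, labelPoly,
      eval_natCast_choosePoly, eval_natCast_choosePoly, Nat.cast_mul]
  rw [Finset.sum_congr rfl hr, ← Nat.cast_sum, labelPoly, eval_natCast_choosePoly]
  congr 1
  have hv' := asc_add_des z v
  rw [asc_append_cons, asc_cons_max hv]
  rw [asc_cons_max hv] at hv'
  have V := sum_antidiagonal_add_choose_mul_add_choose m (asc u) (u.length - asc u) (asc v)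
    (v.length - asc v)
  have hu' := asc_add_des z u
  rw [asc_cons_max hu] at hu'
  rw [Nat.add_sub_of_le (by omega), Nat.add_sub_of_le (by omega),
    Finset.Nat.sum_antidiagonal_eq_sum_range_succ
      (fun i k => (i + asc u).choose u.length * (k + asc v).choose v.length),
    Finset.sum_range_succ'] at V
  -- The convolution also has a term with first index `0`. It vanishes for nonempty `u`, since `asc
  -- u < u.length`; for empty `u` Pascal's rule removes it.
  cases u with
  | nil =>
    simp only [asc, List.nil_append, List.length_cons, List.length_nil] at V ⊢
    simp only [Nat.choose_zero_right, one_mul, add_zero, Nat.sub_zero, zero_add] at V ⊢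
    rw [show asc v + (v.length - asc v) + 1 = v.length + 1 by omega, Nat.choose_succ_succ'] at V
    omega
  | cons a u =>
    have := asc_add_des a u
    rw [Nat.choose_eq_zero_of_lt (by simp; omega : 0 + asc (a :: u) < (a :: u).length), zero_mul,
      add_zero] at V
    rw [V, asc_append_max hu (by simp)]
    congr 1
    · omega
    · simp only [List.length_append, List.length_cons] at *; omega

theorem eval_neg_labelPoly {v : List α} (hv : v.Nodup) (x : ℝ) :
    (labelPoly v).eval (-x) = (-1) ^ v.length * (labelPoly v.reverse).eval x := by
  cases v with
  | nil => simp [labelPoly, asc, eval_choosePoly]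
  | cons a v =>
    have := asc_add_des a v
    rw [labelPoly, labelPoly, List.length_reverse, asc_reverse hv]
    exact eval_neg_choosePoly (by simp; omega) x

theorem eval_labelPoly_eq_labelCount {z : α} {u : List α} (hu : ∀ x ∈ u, x < z) (m : ℕ) :
    (labelPoly u).eval (m : ℝ) = labelCount m (z :: u) := by
  rw [labelCount_cons, asc_cons_max hu, labelPoly, eval_natCast_choosePoly]

/-- The coefficients of the logarithm are those of a Lie element. -/
theorem logCoeff_append_max {z : α} {u v : List α} (hu : ∀ x ∈ u, x < z) (hv : ∀ x ∈ v, x < z)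
    (hvn : v.Nodup) (huv : ∀ x ∈ u, x ∉ v) :
    logCoeff (u ++ z :: v) =
      (-1) ^ v.length * sh (fun r => logCoeff (r ++ [z])) u v.reverse := by
  have hR := coeff_one_convolution (f := labelPoly u) (g := labelPoly v)
    (P := labelPoly (u ++ z :: v))
    (R := C ((-1) ^ v.length) * sh (fun r => labelPoly (r ++ [z])) u v.reverse)
    (eval_labelPoly_append_max hu hv) fun m => ?_
  · rw [logCoeff, hR, coeff_C_mul]
    congr 1
    exact map_sh (lcoeff ℝ 1).toAddMonoidHom (fun r => labelPoly (r ++ [z])) u v.reverse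
  · have hv' : ∀ x ∈ v.reverse, x < z := fun x hx => hv x (by simpa using hx)
    -- With nothing to the right of `z`, the convolution is a plain sum of counts for `r`, to which
    -- the shuffle product applies for each `j`.
    have e : (sh (fun r => labelPoly (r ++ [z])) u v.reverse).eval (m : ℝ) =
        sh (fun r => ∑ j ∈ Finset.range m, labelCount (j + 1) (z :: r)) u v.reverse := by
      refine (map_sh (evalRingHom (m : ℝ)).toAddMonoidHom (fun r => labelPoly (r ++ [z])) u
        v.reverse).trans (sh_congr fun r hr => ?_)
      have hr' : ∀ x ∈ r, x < z := fun x hx => (hr x hx).elim (hu x) (hv' x)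
      refine (eval_labelPoly_append_max hr' (by simp) m).trans
        (Finset.sum_congr rfl fun j _ => ?_)
      rw [← eval_labelPoly_eq_labelCount hr']
      simp [labelPoly, choosePoly]
    rw [eval_mul, eval_C, e, sh_sum, Finset.mul_sum]
    refine Finset.sum_congr rfl fun j _ => ?_
    rw [sh_labelCount _ _ _ _ (by simpa using huv), ← eval_labelPoly_eq_labelCount hu,
      ← eval_labelPoly_eq_labelCount hv', eval_neg_labelPoly hvn]
    push_cast
    ring

end Polynomials

/-! ### Coefficients of nested commutators -/

section NestedWord

variable {n : ℕ}

theorem coeff_letter_mul_cons (a : Fin n) (W : Words n) (w : List (Fin n)) :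
    (letter a * W).coeff (FreeMonoid.ofList (a :: w)) = W.coeff (FreeMonoid.ofList w) := by
  rw [FreeMonoid.ofList_cons]
  exact (MonoidAlgebra.coeff_single_mul_mul W 1 _ _).trans (one_mul _)

theorem coeff_letter_mul_of_ne (a : Fin n) (W : Words n) {w : List (Fin n)}
    (hw : ∀ w', a :: w' ≠ w) : (letter a * W).coeff (FreeMonoid.ofList w) = 0 :=
  MonoidAlgebra.coeff_single_mul_of_forall_mul_ne _ _ fun d h => hw (FreeMonoid.toList d) h

theorem coeff_mul_letter_append (a : Fin n) (W : Words n) (w : List (Fin n)) :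
    (W * letter a).coeff (FreeMonoid.ofList (w ++ [a])) = W.coeff (FreeMonoid.ofList w) := by
  rw [FreeMonoid.ofList_append]
  exact (MonoidAlgebra.coeff_mul_single_mul W 1 _ _).trans (mul_one _)

theorem coeff_mul_letter_of_ne (a : Fin n) (W : Words n) {w : List (Fin n)}
    (hw : ∀ w', w' ++ [a] ≠ w) : (W * letter a).coeff (FreeMonoid.ofList w) = 0 :=
  MonoidAlgebra.coeff_mul_single_of_forall_mul_ne _ _ fun d h => hw (FreeMonoid.toList d) h

theorem nestedWord_cons (a : Fin n) {l : List (Fin n)} (hl : l ≠ []) :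
    nestedWord (a :: l) = letter a * nestedWord l - nestedWord l * letter a := by
  cases l with
  | nil => exact absurd rfl hl
  | cons b l => rfl

/-- A nested commutator is homogeneous in every letter. -/
theorem perm_of_coeff_nestedWord_ne_zero {l w : List (Fin n)}
    (h : (nestedWord l).coeff (FreeMonoid.ofList w) ≠ 0) : w.Perm l := by
  induction l generalizing w with
  | nil => simp [nestedWord] at h
  | cons a l ih =>
    by_cases hl : l = []
    · subst hl
      have hw : FreeMonoid.of a = FreeMonoid.ofList w := by
        by_contra hw
        exact h (Finsupp.single_eq_of_ne (Ne.symm hw))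
      rw [show w = [a] from congrArg FreeMonoid.toList hw.symm]
    · rw [nestedWord_cons a hl, MonoidAlgebra.coeff_sub, Finsupp.sub_apply] at h
      by_cases h₁ : (letter a * nestedWord l).coeff (FreeMonoid.ofList w) = 0
      · rw [h₁, zero_sub, neg_ne_zero] at h
        by_cases hw : ∃ w', w' ++ [a] = w
        · obtain ⟨w', rfl⟩ := hw
          rw [coeff_mul_letter_append] at h
          exact (List.perm_append_singleton a w').trans ((ih h).cons a)
        · exact absurd (coeff_mul_letter_of_ne a _ (not_exists.1 hw)) h
      · by_cases hw : ∃ w', a :: w' = w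
        · obtain ⟨w', rfl⟩ := hw
          rw [coeff_letter_mul_cons] at h₁
          exact (ih h₁).cons a
        · exact absurd (coeff_letter_mul_of_ne a _ (not_exists.1 hw)) h₁

/-- The outermost letter of the commutator is either the first letter of the word, hence the head of
`u`, or, with a minus sign, the last letter, hence the head of `w`. This is the recursion defining
shuffles; `w` is what follows `z`, read backwards. -/
theorem sum_mul_coeff_nestedWord (z : Fin n) (k : ℕ) (g : List (Fin n) → ℝ) (u w : List (Fin n))
    (hu : z ∉ u) (hw : z ∉ w) (hk : u.length + w.length = k) :
    ∑ f : Fin k → Fin n, g (List.ofFn f) *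
      ((nestedWord (List.ofFn f ++ [z])).coeff (FreeMonoid.ofList (u ++ z :: w.reverse)) : ℚ) =
      (-1) ^ w.length * sh g u w := by
  induction k generalizing g u w with
  | zero =>
    obtain rfl : u = [] := List.length_eq_zero_iff.1 (by omega)
    obtain rfl : w = [] := List.length_eq_zero_iff.1 (by omega)
    have : (nestedWord [z]).coeff (FreeMonoid.of z) = 1 := Finsupp.single_eq_same
    simp [this]
  | succ k ih =>
    have hmem : ∀ (l x : List (Fin n)), z ∉ x →
        (nestedWord (l ++ [z])).coeff (FreeMonoid.ofList x) = 0 := by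
      intro l x hx
      by_contra h
      exact hx ((perm_of_coeff_nestedWord_ne_zero h).mem_iff.2 (by simp))
    have hL : ∑ a, ∑ f : Fin k → Fin n, g (a :: List.ofFn f) *
        ((letter a * nestedWord (List.ofFn f ++ [z])).coeff
          (FreeMonoid.ofList (u ++ z :: w.reverse)) : ℚ) =
        match u with
        | [] => (0 : ℝ)
        | b :: u' => (-1) ^ w.length * sh (fun r => g (b :: r)) u' w := by
      cases u with
      | nil =>
        refine Finset.sum_eq_zero fun a _ => Finset.sum_eq_zero fun f _ => ?_
        rw [List.nil_append]
        -- If `u` is empty the word starts with `z`. Removing that letter leaves a word without `z`,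
        -- which has coefficient zero.
        by_cases ha : a = z
        · subst ha
          rw [coeff_letter_mul_cons, hmem _ _ (by simpa using hw), Rat.cast_zero, mul_zero]
        · rw [coeff_letter_mul_of_ne _ _ (by rintro w' h; exact ha (List.cons.inj h).1),
            Rat.cast_zero, mul_zero]
      | cons b u =>
        rw [Finset.sum_eq_single b]
        · simp only [List.cons_append, coeff_letter_mul_cons]
          exact ih (fun r => g (b :: r)) u w (fun h => hu (by simp [h])) hw (by simp at hk; omega)
        · intro a _ ha
          refine Finset.sum_eq_zero fun f _ => ?_
          rw [coeff_letter_mul_of_ne _ _ (by rintro w' h; exact ha (List.cons.inj h).1),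
            Rat.cast_zero, mul_zero]
        · simp
    have hR : ∑ a, ∑ f : Fin k → Fin n, g (a :: List.ofFn f) *
        ((nestedWord (List.ofFn f ++ [z]) * letter a).coeff
          (FreeMonoid.ofList (u ++ z :: w.reverse)) : ℚ) =
        match w with
        | [] => (0 : ℝ)
        | b :: w' => (-1) ^ w'.length * sh (fun r => g (b :: r)) u w' := by
      cases w with
      | nil =>
        refine Finset.sum_eq_zero fun a _ => Finset.sum_eq_zero fun f _ => ?_
        rw [List.reverse_nil]
        by_cases ha : a = z
        · subst ha
          rw [coeff_mul_letter_append, hmem _ _ hu, Rat.cast_zero, mul_zero]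
        · rw [coeff_mul_letter_of_ne _ _ (by
              rintro w' h; exact ha (by simpa using (List.append_inj' h rfl).2)),
            Rat.cast_zero, mul_zero]
      | cons b w =>
        have e : u ++ z :: (b :: w).reverse = (u ++ z :: w.reverse) ++ [b] := by simp
        rw [e, Finset.sum_eq_single b]
        · simp only [coeff_mul_letter_append]
          exact ih (fun r => g (b :: r)) u w hu (fun h => hw (by simp [h])) (by simp at hk; omega)
        · intro a _ ha
          refine Finset.sum_eq_zero fun f _ => ?_
          rw [coeff_mul_letter_of_ne _ _ (by
              rintro w' h; exact ha (by simpa using (List.append_inj' h rfl).2)),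
            Rat.cast_zero, mul_zero]
        · simp
    rw [← (Fin.consEquiv fun _ => Fin n).sum_comp, Fintype.sum_prod_type]
    simp only [Fin.consEquiv, Equiv.coe_fn_mk, List.ofFn_cons, List.cons_append]
    have hne : ∀ (a : Fin n) (f : Fin k → Fin n), nestedWord (a :: (List.ofFn f ++ [z])) =
        letter a * nestedWord (List.ofFn f ++ [z]) - nestedWord (List.ofFn f ++ [z]) * letter a :=
      fun a f => nestedWord_cons a (by simp)
    simp only [hne, MonoidAlgebra.coeff_sub, Finsupp.sub_apply, Rat.cast_sub, mul_sub, Finset.sum_sub_distrib]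
    rw [hL, hR]
    cases u with
    | nil =>
      cases w with
      | nil => simp at hk
      | cons b w => simp [pow_succ]
    | cons a u =>
      cases w with
      | nil => simp
      | cons b w => simp only [sh_cons_cons, List.length_cons, pow_succ]; ring

theorem ofFn_plus {m : ℕ} (σ : Equiv.Perm (Fin m)) :
    List.ofFn (plus σ) = List.ofFn (fun i => (σ i).castSucc) ++ [Fin.last m] := by
  rw [List.ofFn_succ_last]
  simp

/-- Split `τ` at its largest letter and compare the shuffle formulas for `logCoeff` and for nested
commutators. -/
theorem sum_logCoeff_mul_nestedBracket {m : ℕ} (τ : Equiv.Perm (Fin (m + 1))) :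
    ∑ σ : Equiv.Perm (Fin m), logCoeff (List.ofFn (plus σ)) * (nestedBracket (plus σ) τ : ℚ) =
      logCoeff (List.ofFn τ) := by
  have hnd : (List.ofFn τ).Nodup := List.nodup_ofFn.2 τ.injective
  obtain ⟨u, v, huv⟩ := List.append_of_mem (a := Fin.last m) (l := List.ofFn τ)
    ((List.mem_ofFn' _ _).2 (τ.surjective _))
  rw [huv] at hnd
  obtain ⟨hun, hvn, hdis⟩ := List.nodup_append.1 hnd
  have hv : Fin.last m ∉ v := (List.nodup_cons.1 hvn).1
  have hu : Fin.last m ∉ u := fun h => hdis _ h _ (by simp) rfl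
  have hlen : u.length + v.reverse.length = m := by
    have := congrArg List.length huv
    simp at this ⊢
    omega
  have key := sum_mul_coeff_nestedWord (Fin.last m) m (fun r => logCoeff (r ++ [Fin.last m])) u
    v.reverse hu (by simpa using hv) hlen
  rw [List.reverse_reverse, List.length_reverse] at key
  rw [huv, logCoeff_append_max
    (fun x hx => Fin.lt_last_iff_ne_last.2 fun h => hu (h ▸ hx))
    (fun x hx => Fin.lt_last_iff_ne_last.2 fun h => hv (h ▸ hx)) (List.nodup_cons.1 hvn).2
    (fun x hx hx' => hdis x hx x (by simp [hx']) rfl), ← key]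
  -- The shuffle formula sums over all words of length `m`; by homogeneity only the permutations of
  -- the lower letters contribute.
  refine Fintype.sum_of_injective
    (fun (σ : Equiv.Perm (Fin m)) (i : Fin m) => (σ i).castSucc) ?_ _ _ ?_ ?_
  · intro σ σ' h
    ext i
    simpa using congrArg Fin.val (congrFun h i)
  · intro f hf
    by_contra h
    have hp : (u ++ Fin.last m :: v).Perm (List.ofFn f ++ [Fin.last m]) := by
      refine perm_of_coeff_nestedWord_ne_zero fun h' => h ?_
      rw [h', Rat.cast_zero, mul_zero]
    obtain ⟨h₁, -, h₂⟩ := List.nodup_append.1 (hp.nodup_iff.1 hnd)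
    have hne : ∀ i, f i ≠ Fin.last m := fun i =>
      h₂ (f i) ((List.mem_ofFn' _ _).2 ⟨i, rfl⟩) _ (by simp)
    have hinj : Function.Injective fun i => (f i).castPred (hne i) := by
      intro i j hij
      exact List.nodup_ofFn.1 h₁ (by simpa using hij)
    exact hf ⟨Equiv.ofBijective _ (Finite.injective_iff_bijective.1 hinj), by ext i; simp⟩
  · intro σ
    rw [nestedBracket, huv, ofFn_plus]

end NestedWord

/-! ### Cutting words into increasing pieces -/

section Cuts

variable {α : Type*} [LinearOrder α]

open Classical in
/-- The indicator of nonempty increasing words. -/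
def incr (w : List α) : ℝ := if w ≠ [] ∧ w.IsChain (· < ·) then 1 else 0

/-- The number of ways of cutting a word into `k` nonempty increasing words. -/
def cuts : ℕ → List α → ℝ
  | 0, w => if w.length = 0 then 1 else 0
  | k + 1, w => ∑ i ∈ Finset.range (w.length + 1), incr (w.take i) * cuts k (w.drop i)

@[simp] theorem incr_nil : incr ([] : List α) = 0 := by simp [incr]

@[simp] theorem incr_singleton (a : α) : incr [a] = 1 := by simp [incr]

theorem incr_cons_cons (a b : α) (l : List α) :
    incr (a :: b :: l) = if a < b then incr (b :: l) else 0 := by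
  unfold incr
  by_cases h : a < b <;> simp [h]

theorem cuts_succ_cons_cons (k : ℕ) (a b : α) (l : List α) :
    cuts (k + 1) (a :: b :: l) =
      cuts k (b :: l) + if a < b then cuts (k + 1) (b :: l) else 0 := by
  simp only [cuts, List.length_cons]
  rw [Finset.sum_range_succ', Finset.sum_range_succ' _ (l.length + 1)]
  simp only [List.take_succ_cons, List.drop_succ_cons, List.take_zero, List.drop_zero, incr_nil,
    incr_singleton, zero_mul, one_mul, add_zero, incr_cons_cons]
  rw [add_comm]
  congr 1
  split_ifs with h
  · rw [Finset.sum_range_succ' _ (l.length + 1)]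
    simp
  · simp

open Polynomial in
-- A cut is forced at each non-ascent and optional at each ascent; `k + 1` pieces need `k` cuts.
theorem cuts_succ_cons (k : ℕ) (a : α) (l : List α) :
    cuts (k + 1) (a :: l) =
      ((X : ℝ[X]) ^ des (a :: l) * (1 + X) ^ asc (a :: l)).coeff k := by
  induction l generalizing k a with
  | nil =>
    cases k with
    | zero => simp [cuts, asc, des, Finset.sum_range_succ]
    | succ k => simp [cuts, asc, des, Finset.sum_range_succ, coeff_one]
  | cons b l ih =>
    have h₀ : cuts k (b :: l) =
        (X * ((X : ℝ[X]) ^ des (b :: l) * (1 + X) ^ asc (b :: l))).coeff k := by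
      cases k with
      | zero => simp [cuts]
      | succ k => rw [ih, coeff_X_mul]
    rw [cuts_succ_cons_cons, ih, h₀]
    by_cases h : a < b
    · rw [if_pos h, ← coeff_add]
      simp only [des, asc, h, if_true]
      congr 1
      ring
    · rw [if_neg h]
      simp only [des, asc, h, if_false, add_zero]
      congr 1
      ring

open Polynomial in
-- The left side is `∫₀¹ p(-x) dx` for `p = X^d (1 + X)^e`, a Beta integral up to sign; it is
-- evaluated by induction on `e`.
theorem sum_range_mul_coeff (d e n : ℕ) (h : d + e < n) :
    ∑ k ∈ Finset.range n, (-1 : ℝ) ^ k / (k + 1) * ((X : ℝ[X]) ^ d * (1 + X) ^ e).coeff k =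
      (-1) ^ d * (e.factorial * d.factorial / (d + e + 1).factorial) := by
  induction e generalizing d with
  | zero =>
    rw [Finset.sum_eq_single d]
    · have : (d.factorial : ℝ) ≠ 0 := by positivity
      have : (d : ℝ) + 1 ≠ 0 := by positivity
      simp only [pow_zero, mul_one, coeff_X_pow_self, Nat.factorial_zero, add_zero,
        Nat.factorial_succ]
      push_cast
      field_simp
    · intro k _ hk
      simp [coeff_X_pow, hk]
    · intro h'
      exact absurd (Finset.mem_range.2 (by omega)) h'
  | succ e ih =>
    have e₁ : (X : ℝ[X]) ^ d * (1 + X) ^ (e + 1) =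
        X ^ d * (1 + X) ^ e + X ^ (d + 1) * (1 + X) ^ e := by ring
    simp only [e₁, coeff_add, mul_add, Finset.sum_add_distrib]
    rw [ih d (by omega), ih (d + 1) (by omega), show d + 1 + e + 1 = d + e + 1 + 1 by ring,
      show d + (e + 1) + 1 = d + e + 1 + 1 by ring, Nat.factorial_succ (d + e + 1),
      Nat.factorial_succ e, Nat.factorial_succ d]
    have : ((d + e + 1).factorial : ℝ) ≠ 0 := by positivity
    have : (d : ℝ) + e + 1 + 1 ≠ 0 := by positivity
    push_cast
    field_simp
    ring

theorem sum_Icc_mul_cuts {w : List α} (hw : w ≠ []) :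
    ∑ k ∈ Finset.Icc 1 w.length, (-1 : ℝ) ^ (k + 1) / k * cuts k w = logCoeff w := by
  cases w with
  | nil => exact absurd rfl hw
  | cons a l =>
    have h₀ := asc_add_des a l
    have h := sum_range_mul_coeff (des (a :: l)) (asc (a :: l)) (l.length + 1) (by omega)
    rw [logCoeff_eq (List.cons_ne_nil a l), List.length_cons]
    rw [show des (a :: l) + asc (a :: l) = l.length by omega] at h
    rw [← h, Finset.range_eq_Ico, Finset.sum_Ico_eq_sum_range, ← Finset.Ico_add_one_right_eq_Icc,
      Finset.sum_Ico_eq_sum_range]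
    refine Finset.sum_congr rfl fun k _ => ?_
    rw [add_comm 1 k, cuts_succ_cons, zero_add, pow_add, pow_add]
    push_cast
    ring

theorem cuts_map {β : Type*} [LinearOrder β] {f : α → β} (hf : StrictMono f) (k : ℕ)
    (w : List α) : cuts k (w.map f) = cuts k w := by
  have h : ∀ w : List α, incr (w.map f) = incr w := by
    intro w
    simp [incr, List.isChain_map, hf.lt_iff_lt]
  induction k generalizing w with
  | zero => simp [cuts]
  | succ k ih => simp [cuts, ← List.map_take, ← List.map_drop, h, ih]

end Cuts

/-! ### Descents of permutations and the coefficients of the expansion -/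

theorem des_ofFn {α : Type*} [LinearOrder α] {n : ℕ} (f : Fin (n + 1) → α) :
    des (List.ofFn f) = ∑ i : Fin n, if f i.castSucc < f i.succ then 0 else 1 := by
  induction n with
  | zero => simp [des]
  | succ n ih =>
    have h := ih fun i => f i.succ
    rw [List.ofFn_succ] at h
    rw [List.ofFn_succ, List.ofFn_succ, des, h, Fin.sum_univ_succ]
    rfl

theorem card_descents {n : ℕ} (σ : Equiv.Perm (Fin n)) :
    (descents σ).card = des (List.ofFn σ) := by
  cases n with
  | zero => simp [descents, des]
  | succ n =>
    rw [des_ofFn, descents, Finset.card_filter, Fin.sum_univ_castSucc]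
    simp only [Fin.val_last, lt_irrefl, IsEmpty.exists_iff, if_false, add_zero, Fin.val_castSucc]
    refine Finset.sum_congr rfl fun i _ => ?_
    have hi : (i : ℕ) + 1 < n + 1 := by omega
    have hne : σ i.castSucc ≠ σ i.succ := fun h => by
      have := congrArg Fin.val (σ.injective h)
      simp at this
    have e : (∃ h : (i : ℕ) + 1 < n + 1, σ ⟨(i : ℕ) + 1, h⟩ < σ i.castSucc) ↔
        ¬ σ i.castSucc < σ i.succ :=
      ⟨fun ⟨_, h⟩ => h.not_gt, fun h => ⟨hi, lt_of_le_of_ne (not_lt.1 h) hne.symm⟩⟩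
    simp only [e]
    split_ifs <;> rfl

theorem logCoeff_ofFn_plus {m : ℕ} (σ : Equiv.Perm (Fin m)) :
    logCoeff (List.ofFn (plus σ)) = (-1 : ℝ) ^ (descents σ).card / ((m + 1 : ℕ) : ℝ) *
      ((m.choose (descents σ).card : ℕ) : ℝ)⁻¹ := by
  have hmax : ∀ x ∈ List.ofFn fun i => (σ i).castSucc, x < Fin.last m := by
    intro x hx
    obtain ⟨i, rfl⟩ := (List.mem_ofFn' _ _).1 hx
    exact Fin.castSucc_lt_last _
  have hd : des (List.ofFn (plus σ)) = (descents σ).card := by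
    rw [card_descents, ofFn_plus, des_append_max hmax]
    cases m with
    | zero => rfl
    | succ m => rw [des_ofFn, des_ofFn]; simp
  have hne : List.ofFn (plus σ) ≠ [] := by simp
  have hlen : asc (List.ofFn (plus σ)) + des (List.ofFn (plus σ)) = m := by
    obtain ⟨a, l, h⟩ := List.exists_cons_of_ne_nil hne
    have h' := congrArg List.length h
    rw [h, asc_add_des]
    simpa using h'.symm
  rw [logCoeff_eq hne, ← hd]
  set d := des (List.ofFn (plus σ))
  set e := asc (List.ofFn (plus σ))
  -- As `e + d = m`, the quotient `e! d! / (m + 1)!` is `1 / ((m + 1) binom(m, d))`.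
  rw [List.length_ofFn, ← hlen, Nat.cast_choose ℝ (by omega : d ≤ e + d), Nat.add_sub_cancel,
    Nat.factorial_succ]
  have h₁ : (((e + d).factorial : ℕ) : ℝ) ≠ 0 := by positivity
  have h₂ : ((d.factorial : ℕ) : ℝ) ≠ 0 := by positivity
  have h₃ : ((e.factorial : ℕ) : ℝ) ≠ 0 := by positivity
  have h₄ : ((e + d + 1 : ℕ) : ℝ) ≠ 0 := by positivity
  push_cast at h₄ ⊢
  field_simp

/-! ### Iterated integrals over the cube -/

section Cube

/-- Lebesgue measure on the cube `[0, t]ⁿ`. -/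
def cubeMeasure (n : ℕ) (t : ℝ) : Measure (Fin n → ℝ) :=
  Measure.pi fun _ => volume.restrict (Set.Icc 0 t)

theorem cubeMeasure_eq_restrict (n : ℕ) (t : ℝ) :
    cubeMeasure n t = volume.restrict (Set.univ.pi fun _ => Set.Icc 0 t) := by
  rw [volume_pi, Measure.restrict_pi_pi, cubeMeasure]

instance (n : ℕ) (t : ℝ) : IsFiniteMeasure (cubeMeasure n t) := by
  unfold cubeMeasure; infer_instance

theorem volume_eq_coord_eq_zero {n : ℕ} {i j : Fin n} (hij : i ≠ j) :
    volume {u : Fin n → ℝ | u i = u j} = 0 := by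
  have h := Measure.addHaar_submodule (volume : Measure (Fin n → ℝ))
    (LinearMap.ker (LinearMap.proj (R := ℝ) (φ := fun _ : Fin n => ℝ) i - LinearMap.proj j)) ?_
  · convert h using 2
    ext u
    simp [sub_eq_zero]
  · intro h
    have : Pi.single i (1 : ℝ) ∈ LinearMap.ker
        (LinearMap.proj (R := ℝ) (φ := fun _ : Fin n => ℝ) i - LinearMap.proj j) := by
      rw [h]; trivial
    simp [hij] at this

theorem ae_injective (n : ℕ) : ∀ᵐ u : Fin n → ℝ, Function.Injective u := by
  have h : ∀ i j : Fin n, ∀ᵐ u : Fin n → ℝ, u i = u j → i = j := by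
    intro i j
    by_cases hij : i = j
    · simp [hij]
    · rw [ae_iff]
      simpa [hij] using volume_eq_coord_eq_zero hij
  filter_upwards [ae_all_iff.2 fun i => ae_all_iff.2 (h i)] with u hu
  exact fun i j => hu i j

theorem ae_injective_cube (n : ℕ) (t : ℝ) :
    ∀ᵐ u ∂cubeMeasure n t, Function.Injective u := by
  rw [cubeMeasure_eq_restrict]
  exact ae_restrict_of_ae (ae_injective n)

theorem measurableSet_strictMono_comp {n : ℕ} (f : Fin n → Fin n) :
    MeasurableSet {u : Fin n → ℝ | StrictMono (u ∘ f)} := by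
  have : {u : Fin n → ℝ | StrictMono (u ∘ f)} =
      ⋂ i, ⋂ j, ⋂ _ : i < j, {u : Fin n → ℝ | u (f i) < u (f j)} := by
    ext u; simp [StrictMono]
  rw [this]
  exact MeasurableSet.iInter fun i => MeasurableSet.iInter fun j => MeasurableSet.iInter fun _ =>
    measurableSet_lt (measurable_pi_apply _) (measurable_pi_apply _)

theorem permSimplex_eq {n : ℕ} (σ : Equiv.Perm (Fin n)) (t : ℝ) :
    permSimplex σ t = {u | Monotone (u ∘ σ.symm)} ∩ Set.univ.pi fun _ => Set.Icc 0 t := by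
  ext u
  constructor
  · rintro ⟨s, ⟨hs, hs'⟩, rfl⟩
    refine ⟨?_, fun i _ => hs' _⟩
    have : (fun i => s (σ i)) ∘ σ.symm = s := by ext i; simp
    rw [Set.mem_ofPred_eq, this]
    exact hs
  · rintro ⟨h, h'⟩
    exact ⟨u ∘ σ.symm, ⟨h, fun i => h' _ trivial⟩, by ext i; simp⟩

theorem orderedSimplex_eq_permSimplex (n : ℕ) (t : ℝ) :
    orderedSimplex n t = permSimplex (1 : Equiv.Perm (Fin n)) t := by
  simp [permSimplex]

/-- Concatenation of vectors as a measurable equivalence. -/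
def appendMeasurableEquiv (a b : ℕ) :
    (Fin a → ℝ) × (Fin b → ℝ) ≃ᵐ (Fin (a + b) → ℝ) where
  toEquiv := Fin.appendEquiv a b
  measurable_toFun := by
    refine measurable_pi_lambda _ fun i => ?_
    refine Fin.addCases (fun i => ?_) (fun i => ?_) i
    · simp only [Fin.appendEquiv, Equiv.coe_fn_mk, Fin.append_left]; fun_prop
    · simp only [Fin.appendEquiv, Equiv.coe_fn_mk, Fin.append_right]; fun_prop
  measurable_invFun := by
    simp only [Fin.appendEquiv, Equiv.coe_fn_symm_mk]; fun_prop

theorem measurePreserving_append (a b : ℕ) (t : ℝ) :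
    MeasurePreserving (appendMeasurableEquiv a b)
      ((cubeMeasure a t).prod (cubeMeasure b t)) (cubeMeasure (a + b) t) := by
  refine ⟨(appendMeasurableEquiv a b).measurable, ?_⟩
  refine (Measure.pi_eq fun s hs => ?_).symm
  rw [MeasurableEquiv.map_apply]
  have : appendMeasurableEquiv a b ⁻¹' Set.univ.pi s =
      (Set.univ.pi fun i => s (Fin.castAdd b i)) ×ˢ (Set.univ.pi fun i => s (Fin.natAdd a i)) := by
    ext p
    simp only [appendMeasurableEquiv, MeasurableEquiv.coe_mk, Fin.appendEquiv, Equiv.coe_fn_mk,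
      Set.mem_preimage, Set.mem_pi, Set.mem_univ, true_imp_iff, Set.mem_prod]
    constructor
    · exact fun h => ⟨fun i => by simpa using h (Fin.castAdd b i),
        fun i => by simpa using h (Fin.natAdd a i)⟩
    · rintro ⟨h₁, h₂⟩ i
      refine Fin.addCases (fun i => ?_) (fun i => ?_) i
      · simpa using h₁ i
      · simpa using h₂ i
  rw [this, Measure.prod_prod, cubeMeasure, cubeMeasure, Measure.pi_pi, Measure.pi_pi,
    Fin.prod_univ_add]

variable {A : Type*} [NormedRing A]

theorem integrable_take_mul_drop {n a b : ℕ} (h : a + b = n) (t : ℝ) {F G : List ℝ → A}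
    (hF : Integrable (fun u => F (List.ofFn u)) (cubeMeasure a t))
    (hG : Integrable (fun u => G (List.ofFn u)) (cubeMeasure b t)) :
    Integrable (fun u => F ((List.ofFn u).take a) * G ((List.ofFn u).drop a))
      (cubeMeasure n t) := by
  subst h
  rw [← (measurePreserving_append a b t).integrable_comp_emb
    (appendMeasurableEquiv a b).measurableEmbedding]
  convert hF.mul_prod hG using 1
  ext p
  simp [appendMeasurableEquiv, Fin.appendEquiv, List.ofFn_fin_append]

/-- The product `H(u₁) ⋯ H(uₙ)`. -/
def mapProd (H : ℝ → A) (l : List ℝ) : A := (l.map H).prod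

theorem mapProd_ofFn (H : ℝ → A) {n : ℕ} (u : Fin n → ℝ) :
    mapProd H (List.ofFn u) = (List.ofFn fun i => H (u i)).prod := by
  rw [mapProd, List.map_ofFn]; rfl

theorem mapProd_take_mul_drop (H : ℝ → A) (l : List ℝ) (i : ℕ) :
    mapProd H (l.take i) * mapProd H (l.drop i) = mapProd H l := by
  rw [mapProd, mapProd, mapProd, ← List.prod_append, ← List.map_append, List.take_append_drop]

variable {H : ℝ → A} {t : ℝ}

theorem integrable_mapProd (hH : ContinuousOn H (Set.Icc 0 t)) (n : ℕ) :
    Integrable (fun u => mapProd H (List.ofFn u)) (cubeMeasure n t) := by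
  rw [cubeMeasure_eq_restrict]
  refine ContinuousOn.integrableOn_compact (isCompact_univ_pi fun _ => isCompact_Icc) ?_
  simp only [mapProd, List.ofFn_eq_map, List.map_map]
  refine continuousOn_list_prod (f := fun i (u : Fin n → ℝ) => H (u i)) _ fun i _ => ?_
  exact hH.comp (continuous_apply i).continuousOn fun u hu => hu i trivial

variable [NormedAlgebra ℝ A]

theorem integral_take_mul_drop [CompleteSpace A] {n a b : ℕ} (h : a + b = n) (t : ℝ)
    {F G : List ℝ → A}
    (hF : Integrable (fun u => F (List.ofFn u)) (cubeMeasure a t))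
    (hG : Integrable (fun u => G (List.ofFn u)) (cubeMeasure b t)) :
    ∫ u, F ((List.ofFn u).take a) * G ((List.ofFn u).drop a) ∂cubeMeasure n t =
      (∫ u, F (List.ofFn u) ∂cubeMeasure a t) * ∫ u, G (List.ofFn u) ∂cubeMeasure b t := by
  subst h
  rw [← (measurePreserving_append a b t).integral_comp']
  refine Eq.trans ?_ (integral_prod_bilin (ContinuousLinearMap.mul ℝ A) hF hG)
  refine integral_congr_ae (Filter.Eventually.of_forall fun p => ?_)
  simp [appendMeasurableEquiv, Fin.appendEquiv, List.ofFn_fin_append]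

/-- Almost every point has distinct coordinates, so weak and strict monotonicity agree up to a null
set. The strict versions are disjoint for different `σ`. -/
theorem permIntegral_eq_integral_cube {n : ℕ} (H : ℝ → A) (t : ℝ) (σ : Equiv.Perm (Fin n)) :
    permIntegral H t σ = ∫ u, {u : Fin n → ℝ | StrictMono (u ∘ σ.symm)}.indicator
      (fun u => mapProd H (List.ofFn u)) u ∂cubeMeasure n t := by
  rw [integral_indicator (measurableSet_strictMono_comp _), cubeMeasure_eq_restrict,
    Measure.restrict_restrict (measurableSet_strictMono_comp _), permIntegral]
  simp only [mapProd_ofFn]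
  refine setIntegral_congr_set ?_
  rw [permSimplex_eq]
  filter_upwards [ae_injective n] with u hu
  refine propext (and_congr_left fun _ => ⟨fun h => ?_, fun h => ?_⟩)
  · exact Monotone.strictMono_of_injective h (hu.comp σ.symm.injective)
  · exact StrictMono.monotone h

theorem dysonTerm_eq_permIntegral (H : ℝ → A) (t : ℝ) (n : ℕ) :
    dysonTerm H t n = permIntegral H t (1 : Equiv.Perm (Fin n)) := by
  rw [dysonTerm, permIntegral, orderedSimplex_eq_permSimplex]

theorem incr_ofFn {n : ℕ} (hn : n ≠ 0) (u : Fin n → ℝ) (x : A) :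
    incr (List.ofFn u) • x = {u : Fin n → ℝ | StrictMono u}.indicator (fun _ => x) u := by
  have h : (List.ofFn u ≠ [] ∧ (List.ofFn u).IsChain (· < ·)) ↔
      u ∈ {u : Fin n → ℝ | StrictMono u} := by
    rw [List.isChain_iff_pairwise, List.pairwise_ofFn]
    simp [hn, StrictMono]
  unfold incr
  by_cases hu : u ∈ {u : Fin n → ℝ | StrictMono u}
  · rw [if_pos (h.2 hu), one_smul, Set.indicator_of_mem hu]
  · rw [if_neg (mt h.1 hu), zero_smul, Set.indicator_of_notMem hu]

theorem integrable_incr_smul_mapProd (hH : ContinuousOn H (Set.Icc 0 t)) (n : ℕ) :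
    Integrable (fun u => incr (List.ofFn u) • mapProd H (List.ofFn u)) (cubeMeasure n t) := by
  by_cases hn : n = 0
  · subst hn; simp
  · simp only [incr_ofFn hn]
    exact (integrable_mapProd hH n).indicator (measurableSet_strictMono_comp id)

theorem dysonTerm_zero [CompleteSpace A] (H : ℝ → A) (t : ℝ) : dysonTerm H t 0 = 1 := by
  have h : orderedSimplex 0 t = Set.univ := by
    ext s
    simp [orderedSimplex, Subsingleton.monotone]
  rw [dysonTerm, h, Measure.restrict_univ, volume_pi, Measure.pi_of_empty]
  simp

theorem integral_incr_smul_mapProd [CompleteSpace A] (H : ℝ → A) (t : ℝ) (n : ℕ) :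
    ∫ u, incr (List.ofFn u) • mapProd H (List.ofFn u) ∂cubeMeasure n t =
      PowerSeries.coeff n (dysonSeries H t - 1) := by
  by_cases hn : n = 0
  · subst hn
    simp [dysonSeries, dysonTerm_zero]
  · simp only [incr_ofFn hn]
    rw [map_sub, PowerSeries.coeff_one, if_neg hn, sub_zero, dysonSeries, PowerSeries.coeff_mk,
      dysonTerm_eq_permIntegral, permIntegral_eq_integral_cube]
    rfl

theorem cuts_succ_smul_mapProd (k : ℕ) {n : ℕ} (u : Fin n → ℝ) :
    cuts (k + 1) (List.ofFn u) • mapProd H (List.ofFn u) =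
      ∑ i ∈ Finset.range (n + 1),
        (incr ((List.ofFn u).take i) • mapProd H ((List.ofFn u).take i)) *
          (cuts k ((List.ofFn u).drop i) • mapProd H ((List.ofFn u).drop i)) := by
  rw [cuts, List.length_ofFn, Finset.sum_smul]
  refine Finset.sum_congr rfl fun i _ => ?_
  rw [smul_mul_smul_comm, mapProd_take_mul_drop]

theorem integrable_cuts_smul_mapProd (hH : ContinuousOn H (Set.Icc 0 t)) (k n : ℕ) :
    Integrable (fun u => cuts k (List.ofFn u) • mapProd H (List.ofFn u)) (cubeMeasure n t) := by
  induction k generalizing n with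
  | zero =>
    simp only [cuts, List.length_ofFn]
    exact (integrable_mapProd hH n).smul (if n = 0 then (1 : ℝ) else 0)
  | succ k ih =>
    simp only [cuts_succ_smul_mapProd]
    refine integrable_finsetSum _ fun i hi => ?_
    exact integrable_take_mul_drop (F := fun l => incr l • mapProd H l)
      (G := fun l => cuts k l • mapProd H l)
      (Nat.add_sub_of_le (Nat.lt_succ_iff.1 (Finset.mem_range.1 hi))) t
      (integrable_incr_smul_mapProd hH i) (ih (n - i))

/-- Summing over the end of the first piece matches the Cauchy product: for each cut position Fubini
separates the two blocks of variables. -/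
theorem integral_cuts_smul_mapProd [CompleteSpace A] (hH : ContinuousOn H (Set.Icc 0 t))
    (k n : ℕ) :
    ∫ u, cuts k (List.ofFn u) • mapProd H (List.ofFn u) ∂cubeMeasure n t =
      PowerSeries.coeff n ((dysonSeries H t - 1) ^ k) := by
  induction k generalizing n with
  | zero =>
    simp only [cuts, List.length_ofFn, pow_zero, PowerSeries.coeff_one]
    split_ifs with hn
    · subst hn
      rw [cubeMeasure, Measure.pi_of_empty]
      simp [mapProd]
    · simp
  | succ k ih =>
    simp only [cuts_succ_smul_mapProd]
    have hle : ∀ i ∈ Finset.range (n + 1), i + (n - i) = n := fun i hi =>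
      Nat.add_sub_of_le (Nat.lt_succ_iff.1 (Finset.mem_range.1 hi))
    rw [integral_finsetSum _ fun i hi =>
      integrable_take_mul_drop (F := fun l => incr l • mapProd H l)
        (G := fun l => cuts k l • mapProd H l) (hle i hi) t
        (integrable_incr_smul_mapProd hH i) (integrable_cuts_smul_mapProd hH k (n - i)),
      pow_succ', PowerSeries.coeff_mul,
      Finset.Nat.sum_antidiagonal_eq_sum_range_succ
        (fun i j => PowerSeries.coeff i (dysonSeries H t - 1) *
          PowerSeries.coeff j ((dysonSeries H t - 1) ^ k))]
    refine Finset.sum_congr rfl fun i hi => ?_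
    rw [integral_take_mul_drop (F := fun l => incr l • mapProd H l)
        (G := fun l => cuts k l • mapProd H l) (hle i hi) t
        (integrable_incr_smul_mapProd hH i) (integrable_cuts_smul_mapProd hH k (n - i)),
      integral_incr_smul_mapProd, ih]

/-- The word `u` is the image of the word `σ` under the increasing map `u ∘ σ.symm`. -/
theorem cuts_eq_of_strictMono {n : ℕ} {u : Fin n → ℝ} {σ : Equiv.Perm (Fin n)}
    (h : StrictMono (u ∘ σ.symm)) (k : ℕ) : cuts k (List.ofFn u) = cuts k (List.ofFn σ) := by
  rw [← cuts_map h, List.map_ofFn]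
  congr 2
  ext i
  simp

theorem eq_of_strictMono_comp_symm {n : ℕ} {u : Fin n → ℝ} {σ τ : Equiv.Perm (Fin n)}
    (hσ : StrictMono (u ∘ σ.symm)) (hτ : StrictMono (u ∘ τ.symm)) : σ = τ := by
  have key : ∀ {σ : Equiv.Perm (Fin n)}, StrictMono (u ∘ σ.symm) → σ.symm = Tuple.sort u :=
    fun h => Tuple.eq_sort_iff.2 ⟨h.monotone, fun i j hij h' => absurd h' (h hij).ne⟩
  exact Equiv.symm_bijective.injective ((key hσ).trans (key hτ).symm)

/-- At almost every `u` exactly one indicator is nonzero, that of the inverse of the sorting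
permutation. -/
theorem coeff_pow_eq_sum_permIntegral [CompleteSpace A] (hH : ContinuousOn H (Set.Icc 0 t))
    (k n : ℕ) :
    PowerSeries.coeff n ((dysonSeries H t - 1) ^ k) =
      ∑ σ : Equiv.Perm (Fin n), cuts k (List.ofFn σ) • permIntegral H t σ := by
  rw [← integral_cuts_smul_mapProd hH]
  simp only [permIntegral_eq_integral_cube, ← integral_smul]
  rw [← integral_finsetSum]
  swap
  · exact fun σ _ => ((integrable_mapProd hH n).indicator
      (measurableSet_strictMono_comp _)).smul (cuts k (List.ofFn σ))
  refine integral_congr_ae ?_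
  filter_upwards [ae_injective_cube n t] with u hu
  have hs : StrictMono (u ∘ (Tuple.sort u).symm.symm) :=
    (Tuple.monotone_sort u).strictMono_of_injective (hu.comp (Tuple.sort u).injective)
  rw [Finset.sum_eq_single (Tuple.sort u).symm]
  · rw [Set.indicator_of_mem (by exact hs), cuts_eq_of_strictMono hs]
  · intro σ _ hσ
    rw [Set.indicator_of_notMem, smul_zero]
    exact fun h => hσ (eq_of_strictMono_comp_symm h hs)
  · simp

theorem formalLog_dysonSeries [CompleteSpace A] (hH : ContinuousOn H (Set.Icc 0 t)) :
    formalLog (dysonSeries H t) = PowerSeries.mk (nestedTerm H t) := by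
  ext n
  rw [formalLog, PowerSeries.coeff_mk, PowerSeries.coeff_mk]
  cases n with
  | zero => simp [nestedTerm]
  | succ m =>
    simp only [coeff_pow_eq_sum_permIntegral hH, Finset.smul_sum]
    rw [Finset.sum_comm]
    simp only [nestedTerm, bracketIntegral, permAction, ← logCoeff_ofFn_plus, Finset.smul_sum]
    rw [Finset.sum_comm (s := (Finset.univ : Finset (Equiv.Perm (Fin m))))]
    refine Finset.sum_congr rfl fun τ _ => ?_
    simp only [smul_smul, ← Finset.sum_smul]
    rw [sum_logCoeff_mul_nestedBracket, ← sum_Icc_mul_cuts (by simp), List.length_ofFn]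

end Cube

/-! ### The Dyson series -/

section Dyson

open Set

theorem monotone_snoc_iff {n : ℕ} (u : Fin n → ℝ) (r : ℝ) :
    Monotone (Fin.snoc (α := fun _ => ℝ) u r) ↔ Monotone u ∧ ∀ i, u i ≤ r := by
  constructor
  · intro h
    refine ⟨fun i j hij => ?_, fun i => ?_⟩
    · simpa using h (Fin.castSucc_le_castSucc_iff.2 hij)
    · simpa using h (Fin.le_last i.castSucc)
  · rintro ⟨h, h'⟩ i j hij
    cases i using Fin.lastCases with
    | last =>
      obtain rfl : j = Fin.last n := le_antisymm (Fin.le_last j) hij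
      exact le_rfl
    | cast i =>
      cases j using Fin.lastCases with
      | last => simpa using h' i
      | cast j => simpa using h (Fin.castSucc_le_castSucc_iff.1 hij)

theorem snoc_mem_orderedSimplex {n : ℕ} (u : Fin n → ℝ) (r s : ℝ) :
    (Fin.snoc (α := fun _ => ℝ) u r) ∈ orderedSimplex (n + 1) s ↔
      r ∈ Icc 0 s ∧ u ∈ orderedSimplex n r := by
  have h : (Fin.snoc (α := fun _ => ℝ) u r) ∈ orderedSimplex (n + 1) s ↔
      (Monotone u ∧ ∀ i, u i ≤ r) ∧ (∀ i, 0 ≤ u i ∧ u i ≤ s) ∧ 0 ≤ r ∧ r ≤ s := by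
    rw [orderedSimplex, mem_ofPred, monotone_snoc_iff, Fin.forall_fin_succ']
    simp
  rw [h]
  constructor
  · rintro ⟨⟨h₁, h₂⟩, h₃, h₄⟩
    exact ⟨h₄, h₁, fun i => ⟨(h₃ i).1, h₂ i⟩⟩
  · rintro ⟨h₁, h₂, h₃⟩
    exact ⟨⟨h₂, fun i => (h₃ i).2⟩, fun i => ⟨(h₃ i).1, (h₃ i).2.trans h₁.2⟩, h₁⟩

theorem measurableSet_orderedSimplex (n : ℕ) (s : ℝ) : MeasurableSet (orderedSimplex n s) := by
  have : orderedSimplex n s = {u | Monotone u} ∩ univ.pi fun _ => Icc 0 s := by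
    ext u; simp only [orderedSimplex, mem_inter_iff, mem_ofPred, mem_univ_pi, mem_Icc]
  rw [this]
  exact isClosed_monotone.measurableSet.inter
    (MeasurableSet.univ_pi fun _ => measurableSet_Icc)

theorem orderedSimplex_subset {n : ℕ} {s t : ℝ} (hst : s ≤ t) :
    orderedSimplex n s ⊆ univ.pi fun _ => Icc 0 t :=
  fun _ hu i _ => ⟨(hu.2 i).1, (hu.2 i).2.trans hst⟩

variable {A : Type*} [NormedRing A] {H : ℝ → A} {t : ℝ}

theorem integrable_indicator_orderedSimplex (hH : ContinuousOn H (Icc 0 t)) {s : ℝ}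
    (hs : s ≤ t) (n : ℕ) :
    Integrable ((orderedSimplex n s).indicator fun u => mapProd H (List.ofFn u)) := by
  rw [integrable_indicator_iff (measurableSet_orderedSimplex n s)]
  have h := integrable_mapProd hH n
  rw [cubeMeasure_eq_restrict] at h
  exact IntegrableOn.mono_set h (orderedSimplex_subset hs)

theorem intervalIntegrable_of_continuousOn {E : Type*} [NormedAddCommGroup E] {f : ℝ → E} {s : ℝ}
    (hf : ContinuousOn f (Icc 0 t)) (hs : s ∈ Icc 0 t) : IntervalIntegrable f volume 0 s :=
  (hf.mono (Icc_subset_Icc_right hs.2)).intervalIntegrable_of_Icc hs.1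

/-- `∫₀ˢ ‖H‖`. -/
def normIntegral (H : ℝ → A) (s : ℝ) : ℝ := ∫ r in (0 : ℝ)..s, ‖H r‖

theorem continuousOn_normIntegral (ht : 0 ≤ t) (hH : ContinuousOn H (Icc 0 t)) :
    ContinuousOn (normIntegral H) (Icc 0 t) := by
  have h := intervalIntegral.continuousOn_primitive_interval (μ := volume) (a := 0) (b := t)
    (f := fun r => ‖H r‖) (by rw [uIcc_of_le ht]; exact hH.norm.integrableOn_Icc)
  rwa [uIcc_of_le ht] at h

theorem integral_normIntegral_pow (ht : 0 ≤ t) (hH : ContinuousOn H (Icc 0 t)) {s : ℝ}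
    (hs : s ∈ Icc 0 t) (n : ℕ) :
    ∫ r in (0 : ℝ)..s, normIntegral H r ^ n / n.factorial * ‖H r‖ =
      normIntegral H s ^ (n + 1) / (n + 1).factorial := by
  have hα := continuousOn_normIntegral ht hH
  rw [intervalIntegral.integral_eq_sub_of_hasDerivAt_of_le
    (f := fun r => normIntegral H r ^ (n + 1) / (n + 1).factorial) hs.1]
  · simp [normIntegral]
  · exact ((hα.mono (Icc_subset_Icc_right hs.2)).pow _).div_const _
  · intro r hr
    have hr' : r ∈ Ioo 0 t := ⟨hr.1, hr.2.trans_le hs.2⟩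
    have h₁ : HasDerivAt (normIntegral H) ‖H r‖ r :=
      intervalIntegral.integral_hasDerivAt_right
        (intervalIntegrable_of_continuousOn hH.norm (Ioo_subset_Icc_self hr'))
        ((hH.norm.mono Ioo_subset_Icc_self).stronglyMeasurableAtFilter isOpen_Ioo r hr')
        (hH.norm.continuousAt (Icc_mem_nhds hr'.1 hr'.2))
    have h₂ := (h₁.pow (n + 1)).div_const ((n + 1).factorial : ℝ)
    refine HasDerivAt.congr_deriv h₂ ?_
    have : (n.factorial : ℝ) ≠ 0 := by positivity
    have : (n : ℝ) + 1 ≠ 0 := by positivity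
    rw [Nat.factorial_succ, Nat.add_sub_cancel]
    push_cast
    field_simp
  · exact intervalIntegrable_of_continuousOn (((hα.pow n).div_const _).mul hH.norm) hs

variable [NormedAlgebra ℝ A]

theorem dysonTerm_eq_integral_indicator (H : ℝ → A) (s : ℝ) (n : ℕ) :
    dysonTerm H s n = ∫ u, (orderedSimplex n s).indicator (fun u => mapProd H (List.ofFn u)) u := by
  rw [integral_indicator (measurableSet_orderedSimplex n s), dysonTerm]
  simp only [mapProd_ofFn]

/-- Fubini with the last, and largest, variable `r` outermost: the others range over the simplex up
to `r`. -/
theorem dysonTerm_succ (hH : ContinuousOn H (Icc 0 t)) {s : ℝ} (hs : s ∈ Icc 0 t) (n : ℕ) :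
    dysonTerm H s (n + 1) = ∫ r in (0 : ℝ)..s, dysonTerm H r n * H r := by
  have hmp := (volume_preserving_piFinSuccAbove (fun _ => ℝ) (Fin.last n)).symm
  have hsnoc : ∀ (r : ℝ) (u : Fin n → ℝ),
      (MeasurableEquiv.piFinSuccAbove (fun _ : Fin (n + 1) => ℝ) (Fin.last n)).symm (r, u) =
        Fin.snoc (α := fun _ => ℝ) u r := by
    intro r u
    rw [MeasurableEquiv.piFinSuccAbove_symm_apply]
    exact Fin.insertNth_last' r u
  have key : ∀ (r : ℝ) (u : Fin n → ℝ),
      (orderedSimplex (n + 1) s).indicator (fun u => mapProd H (List.ofFn u))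
        (Fin.snoc (α := fun _ => ℝ) u r) = (Icc 0 s).indicator (fun r =>
          (orderedSimplex n r).indicator (fun u => mapProd H (List.ofFn u)) u * H r) r := by
    intro r u
    by_cases hr : r ∈ Icc 0 s
    · rw [indicator_of_mem hr]
      by_cases hu : u ∈ orderedSimplex n r
      · rw [indicator_of_mem hu, indicator_of_mem ((snoc_mem_orderedSimplex u r s).2 ⟨hr, hu⟩),
          List.ofFn_succ_last]
        simp [mapProd]
      · rw [indicator_of_notMem hu, zero_mul, indicator_of_notMem]
        exact fun h => hu ((snoc_mem_orderedSimplex u r s).1 h).2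
    · rw [indicator_of_notMem hr, indicator_of_notMem]
      exact fun h => hr ((snoc_mem_orderedSimplex u r s).1 h).1
  have hint := (hmp.integrable_comp_emb (MeasurableEquiv.measurableEmbedding _)).2
    (integrable_indicator_orderedSimplex hH hs.2 (n + 1))
  rw [Function.comp_def, Measure.volume_eq_prod] at hint
  rw [dysonTerm_eq_integral_indicator, ← hmp.integral_comp', Measure.volume_eq_prod,
    integral_prod _ hint, intervalIntegral.integral_of_le hs.1, ← integral_Icc_eq_integral_Ioc,
    ← integral_indicator measurableSet_Icc]
  refine integral_congr_ae (Filter.Eventually.of_forall fun r => ?_)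
  simp only [hsnoc, key]
  by_cases hr : r ∈ Icc 0 s
  · simp only [indicator_of_mem hr]
    rw [integral_mul_const_of_integrable
      (integrable_indicator_orderedSimplex hH (hr.2.trans hs.2) n),
      dysonTerm_eq_integral_indicator]
  · simp only [indicator_of_notMem hr, integral_zero]

theorem norm_integral_mul_le (ht : 0 ≤ t) (hH : ContinuousOn H (Icc 0 t)) {F : ℝ → A} {n : ℕ}
    {M : ℝ} (hF : ∀ r ∈ Icc 0 t, ‖F r‖ ≤ M * (normIntegral H r ^ n / n.factorial)) {s : ℝ}
    (hs : s ∈ Icc 0 t) :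
    ‖∫ r in (0 : ℝ)..s, F r * H r‖ ≤
      M * (normIntegral H s ^ (n + 1) / (n + 1).factorial) := by
  rw [← integral_normIntegral_pow ht hH hs, ← intervalIntegral.integral_const_mul]
  refine intervalIntegral.norm_integral_le_of_norm_le hs.1
    (Filter.Eventually.of_forall fun r hr => ?_) ?_
  · refine (norm_mul_le _ _).trans ?_
    rw [← mul_assoc]
    exact mul_le_mul_of_nonneg_right (hF r ⟨hr.1.le, hr.2.trans hs.2⟩) (norm_nonneg _)
  · exact intervalIntegrable_of_continuousOn (continuousOn_const.mul
      ((((continuousOn_normIntegral ht hH).pow n).div_const _).mul hH.norm)) hs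

variable [CompleteSpace A]

theorem continuousOn_dysonTerm (ht : 0 ≤ t) (hH : ContinuousOn H (Icc 0 t)) (n : ℕ) :
    ContinuousOn (fun s => dysonTerm H s n) (Icc 0 t) := by
  induction n with
  | zero => simp only [dysonTerm_zero]; exact continuousOn_const
  | succ n ih =>
    have h := intervalIntegral.continuousOn_primitive_interval (μ := volume) (a := 0) (b := t)
      (f := fun r => dysonTerm H r n * H r)
      (by rw [uIcc_of_le ht]; exact (ih.mul hH).integrableOn_Icc)
    rw [uIcc_of_le ht] at h
    exact h.congr fun s hs => dysonTerm_succ hH hs n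

/-- Degree zero is excluded because `‖1‖ ≤ 1` is not assumed in `A`; the induction starts from `∫
‖H‖`. -/
theorem norm_dysonTerm_succ_le (ht : 0 ≤ t) (hH : ContinuousOn H (Icc 0 t)) (n : ℕ) {s : ℝ}
    (hs : s ∈ Icc 0 t) :
    ‖dysonTerm H s (n + 1)‖ ≤ normIntegral H s ^ (n + 1) / (n + 1).factorial := by
  induction n generalizing s with
  | zero =>
    rw [dysonTerm_succ hH hs]
    simp only [dysonTerm_zero, one_mul, zero_add, pow_one, Nat.factorial_one, Nat.cast_one, div_one]
    exact intervalIntegral.norm_integral_le_integral_norm hs.1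
  | succ n ih =>
    rw [dysonTerm_succ hH hs, ← one_mul (_ / _)]
    exact norm_integral_mul_le ht hH (fun r hr => by rw [one_mul]; exact ih hr) hs

theorem summable_norm_dysonTerm (ht : 0 ≤ t) (hH : ContinuousOn H (Icc 0 t)) :
    Summable fun n => ‖dysonTerm H t n‖ := by
  rw [← summable_nat_add_iff 1]
  exact Summable.of_nonneg_of_le (fun _ => norm_nonneg _)
    (fun n => norm_dysonTerm_succ_le ht hH n ⟨ht, le_rfl⟩)
    ((summable_nat_add_iff 1).2 (Real.summable_pow_div_factorial (normIntegral H t)))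

theorem hasSum_dysonTerm (ht : 0 ≤ t) (hH : ContinuousOn H (Icc 0 t)) {X : ℝ → A} (h₀ : X 0 = 1)
    (hX : ∀ s ∈ Icc 0 t, HasDerivWithinAt X (X s * H s) (Icc 0 t) s) :
    HasSum (dysonTerm H t) (X t) := by
  have hXc : ContinuousOn X (Icc 0 t) := fun s hs => (hX s hs).continuousWithinAt
  have hXint : ∀ s ∈ Icc 0 t, X s = 1 + ∫ r in (0 : ℝ)..s, X r * H r := by
    intro s hs
    rw [intervalIntegral.integral_eq_sub_of_hasDerivAt_of_le hs.1
      (hXc.mono (Icc_subset_Icc_right hs.2)), h₀, add_sub_cancel]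
    · intro r hr
      exact (hX r ⟨hr.1.le, hr.2.le.trans hs.2⟩).hasDerivAt
        (Icc_mem_nhds hr.1 (hr.2.trans_le hs.2))
    · exact intervalIntegrable_of_continuousOn (hXc.mul hH) hs
  obtain ⟨M, hM⟩ := (isCompact_Icc (a := (0 : ℝ)) (b := t)).exists_bound_of_continuousOn hXc
  -- The remainder of order `N + 1` is the integral of the remainder of order `N` times `H`, by the
  -- integral equation for `X`. Each step gains a factor as in the exponential series.
  have hrem : ∀ N : ℕ, ∀ s ∈ Icc 0 t, ‖X s - ∑ n ∈ Finset.range N, dysonTerm H s n‖ ≤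
      M * (normIntegral H s ^ N / N.factorial) := by
    intro N
    induction N with
    | zero => intro s hs; simpa using hM s hs
    | succ N ih =>
      intro s hs
      have hsum : ContinuousOn (fun s => ∑ n ∈ Finset.range N, dysonTerm H s n) (Icc 0 t) :=
        continuousOn_finsetSum _ fun n _ => continuousOn_dysonTerm ht hH n
      have e : X s - ∑ n ∈ Finset.range (N + 1), dysonTerm H s n =
          ∫ r in (0 : ℝ)..s, (X r - ∑ n ∈ Finset.range N, dysonTerm H r n) * H r := by
        simp only [sub_mul]
        have i₁ : IntervalIntegrable (fun r => X r * H r) volume 0 s :=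
          intervalIntegrable_of_continuousOn (hXc.mul hH) hs
        have i₂ : IntervalIntegrable (fun r => (∑ n ∈ Finset.range N, dysonTerm H r n) * H r)
            volume 0 s := intervalIntegrable_of_continuousOn (hsum.mul hH) hs
        have i₃ : ∀ n ∈ Finset.range N, IntervalIntegrable (fun r => dysonTerm H r n * H r)
            volume 0 s := fun n _ => intervalIntegrable_of_continuousOn
          ((continuousOn_dysonTerm ht hH n).mul hH) hs
        rw [intervalIntegral.integral_sub i₁ i₂]
        simp only [Finset.sum_mul]
        rw [intervalIntegral.integral_finsetSum i₃, Finset.sum_range_succ', hXint s hs,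
          dysonTerm_zero, Finset.sum_congr rfl fun n _ => dysonTerm_succ hH hs n]
        abel
      rw [e]
      exact norm_integral_mul_le ht hH ih hs
  rw [(summable_norm_dysonTerm ht hH).of_norm.hasSum_iff_tendsto_nat,
    tendsto_iff_norm_sub_tendsto_zero]
  refine squeeze_zero (fun _ => norm_nonneg _) (fun N => ?_)
    (by simpa using (FloorSemiring.tendsto_pow_div_factorial_atTop (normIntegral H t)).const_mul M)
  rw [norm_sub_rev]
  exact hrem N t ⟨ht, le_rfl⟩

end Dyson

/-! ### Convergence of the logarithm -/

section Convergence

open PowerSeries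

theorem hasSum_coeff_pow {R : Type*} [NormedRing R] [CompleteSpace R] {f : PowerSeries R} {x : R}
    (hf : Summable fun n => ‖coeff n f‖) (hx : HasSum (fun n => coeff n f) x) (k : ℕ) :
    (Summable fun n => ‖coeff n (f ^ k)‖) ∧ HasSum (fun n => coeff n (f ^ k)) (x ^ k) := by
  induction k with
  | zero =>
    have h : ∀ n : ℕ, n ∉ ({0} : Finset ℕ) → coeff n (1 : PowerSeries R) = 0 := by
      intro n hn
      rw [coeff_one, if_neg (by simpa using hn)]
    simp only [pow_zero]
    refine ⟨summable_of_ne_finset_zero (s := {0}) fun n hn => by rw [h n hn, norm_zero], ?_⟩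
    simpa using hasSum_sum_of_ne_finset_zero h
  | succ k ih =>
    have hs := summable_norm_sum_mul_antidiagonal_of_summable_norm
      (f := fun n => coeff n (f ^ k)) (g := fun n => coeff n f) ih.1 hf
    have h := tsum_mul_tsum_eq_tsum_sum_antidiagonal_of_summable_norm
      (f := fun n => coeff n (f ^ k)) (g := fun n => coeff n f) ih.1 hf
    rw [ih.2.tsum_eq, hx.tsum_eq] at h
    simp only [pow_succ _ k, coeff_mul]
    exact ⟨hs, h ▸ hs.of_norm.hasSum⟩

theorem norm_coeff_pow_succ_le {R : Type*} [NormedRing R] {f : PowerSeries R}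
    {b : PowerSeries ℝ} (h : ∀ n, ‖coeff n f‖ ≤ coeff n b) (k n : ℕ) :
    ‖coeff n (f ^ (k + 1))‖ ≤ coeff n (b ^ (k + 1)) := by
  induction k generalizing n with
  | zero => simpa using h n
  | succ k ih =>
    rw [pow_succ, coeff_mul, pow_succ _ (k + 1), coeff_mul]
    refine (norm_sum_le _ _).trans (Finset.sum_le_sum fun x _ => ?_)
    exact (norm_mul_le _ _).trans (mul_le_mul (ih _) (h _) (norm_nonneg _)
      ((norm_nonneg _).trans (ih _)))

theorem coeff_pow_eq_zero {R : Type*} [Ring R] {f : PowerSeries R} (hf : coeff 0 f = 0) {k n : ℕ}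
    (hn : n < k) : coeff n (f ^ k) = 0 := by
  induction k generalizing n with
  | zero => omega
  | succ k ih =>
    rw [pow_succ', coeff_mul]
    refine Finset.sum_eq_zero fun x hx => ?_
    rw [Finset.HasAntidiagonal.mem_antidiagonal] at hx
    by_cases h : x.1 = 0
    · rw [h, hf, zero_mul]
    · rw [ih (by omega), mul_zero]

/-- If the power series `f`, without constant term, is dominated by a series whose sum is less than
`1`, then `∑ₖ (-1)ᵏ/(k+1) f^{k+1}` can be summed by powers of `f` or by degree. -/
theorem exists_hasSum_log {A : Type*} [NormedRing A] [NormedAlgebra ℝ A] [CompleteSpace A]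
    {f : PowerSeries A} {b : PowerSeries ℝ} {x : A} {y : ℝ} (hf : coeff 0 f = 0)
    (h : ∀ n, ‖coeff n f‖ ≤ coeff n b) (hx : HasSum (fun n => coeff n f) x)
    (hy : HasSum (fun n => coeff n b) y) (hy₁ : y < 1) :
    ∃ Ω : A, HasSum (fun k : ℕ => ((-1 : ℝ) ^ k / ((k : ℝ) + 1)) • x ^ (k + 1)) Ω ∧
      HasSum (fun n : ℕ => ∑ k ∈ Finset.Icc 1 n,
        ((-1 : ℝ) ^ (k + 1) / (k : ℝ)) • coeff n (f ^ k)) Ω := by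
  have hb : ∀ n, 0 ≤ coeff n b := fun n => (norm_nonneg _).trans (h n)
  have hy₀ : 0 ≤ y := hy.nonneg hb
  have hbs : Summable fun n => ‖coeff n b‖ := hy.summable.norm
  have hfs : Summable fun n => ‖coeff n f‖ :=
    Summable.of_nonneg_of_le (fun _ => norm_nonneg _) h hy.summable
  -- Summing the majorant over degrees first leaves the geometric series of `y^(k+1)`.
  have hB : Summable fun p : ℕ × ℕ => coeff p.2 (b ^ (p.1 + 1)) := by
    rw [summable_prod_of_nonneg fun p => (norm_nonneg _).trans (norm_coeff_pow_succ_le h p.1 p.2)]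
    refine ⟨fun k => (hasSum_coeff_pow hbs hy (k + 1)).2.summable, ?_⟩
    simp only [(hasSum_coeff_pow hbs hy _).2.tsum_eq]
    exact (summable_nat_add_iff 1).2 (summable_geometric_of_lt_one hy₀ hy₁)
  set F : ℕ × ℕ → A := fun p => ((-1 : ℝ) ^ p.1 / ((p.1 : ℝ) + 1)) • coeff p.2 (f ^ (p.1 + 1))
    with hF
  have hFs : Summable F := by
    refine Summable.of_norm_bounded hB fun p => ?_
    rw [hF, norm_smul, norm_div, norm_pow, norm_neg, norm_one, one_pow, Real.norm_of_nonneg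
      (by positivity)]
    refine (mul_le_of_le_one_left (norm_nonneg _) ?_).trans (norm_coeff_pow_succ_le h p.1 p.2)
    rw [div_le_one (by positivity)]
    linarith [(Nat.cast_nonneg p.1 : (0 : ℝ) ≤ p.1)]
  refine ⟨∑' p, F p, hFs.hasSum.prod_fiberwise fun k =>
    (hasSum_coeff_pow hfs hx (k + 1)).2.const_smul _, ?_⟩
  refine HasSum.prod_fiberwise (f := F ∘ Prod.swap) ((Equiv.prodComm ℕ ℕ).hasSum_iff.2 hFs.hasSum)
    fun n => ?_
  have e : ∑ k ∈ Finset.Icc 1 n, ((-1 : ℝ) ^ (k + 1) / (k : ℝ)) • coeff n (f ^ k) =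
      ∑ k ∈ Finset.range n, F (k, n) := by
    rw [← Finset.Ico_add_one_right_eq_Icc, Finset.sum_Ico_eq_sum_range]
    refine Finset.sum_congr rfl fun k _ => ?_
    rw [hF, add_comm 1 k, pow_succ, pow_succ]
    push_cast
    congr 2
    ring
  rw [e]
  -- In degree `n` only finitely many powers survive, as `f^(k+1)` is divisible by `λ^(k+1)`.
  refine hasSum_sum_of_ne_finset_zero fun k hk => ?_
  rw [Finset.mem_range, not_lt] at hk
  show F (k, n) = 0
  rw [hF]
  show _ • coeff n (f ^ (k + 1)) = 0
  rw [coeff_pow_eq_zero hf (by omega), smul_zero]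

theorem exists_hasSum_log_dyson {A : Type*} [NormedRing A] [NormedAlgebra ℝ A] [CompleteSpace A]
    {H : ℝ → A} {t : ℝ} (ht : 0 ≤ t) (hH : ContinuousOn H (Set.Icc 0 t)) {x : A}
    (hx : HasSum (dysonTerm H t) x) (hlog : (∫ s in (0 : ℝ)..t, ‖H s‖) < Real.log 2) :
    ∃ Ω : A, HasSum (fun k : ℕ => ((-1 : ℝ) ^ k / ((k : ℝ) + 1)) • (x - 1) ^ (k + 1)) Ω ∧
      HasSum (nestedTerm H t) Ω := by
  have h₁ : ∀ n : ℕ, n ∉ ({0} : Finset ℕ) → coeff n (1 : PowerSeries A) = 0 := by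
    intro n hn
    rw [coeff_one, if_neg (by simpa using hn)]
  have h₁' : ∀ n : ℕ, n ∉ ({0} : Finset ℕ) → coeff n (1 : PowerSeries ℝ) = 0 := by
    intro n hn
    rw [coeff_one, if_neg (by simpa using hn)]
  set a := normIntegral H t with ha
  have hexp : HasSum (fun n : ℕ => a ^ n / n.factorial) (Real.exp a) := by
    rw [Real.exp_eq_exp_ℝ]
    exact NormedSpace.expSeries_div_hasSum_exp a
  -- The bound `log 2` is exactly what makes the sum of the majorant `exp(aλ) - 1` at `λ = 1`
  -- smaller than one.
  have hlt : Real.exp a - 1 < 1 := by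
    have := Real.exp_lt_exp.2 hlog
    rw [Real.exp_log two_pos] at this
    change Real.exp a < 2 at this
    linarith
  have hle : ∀ n, ‖coeff n (dysonSeries H t - 1)‖ ≤
      coeff n (PowerSeries.mk (fun n : ℕ => a ^ n / n.factorial) - 1) := by
    intro n
    cases n with
    | zero => simp [dysonSeries, dysonTerm_zero]
    | succ n =>
      rw [map_sub, map_sub, coeff_one, coeff_one, if_neg n.succ_ne_zero, if_neg n.succ_ne_zero,
        sub_zero, sub_zero, dysonSeries, coeff_mk, coeff_mk]
      exact norm_dysonTerm_succ_le ht hH n ⟨ht, le_rfl⟩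
  have hf : HasSum (fun n => coeff n (dysonSeries H t - 1)) (x - 1) := by
    simp only [map_sub, dysonSeries, coeff_mk]
    exact hx.sub (by simpa using hasSum_sum_of_ne_finset_zero h₁)
  have hb : HasSum (fun n => coeff n (PowerSeries.mk (fun n : ℕ => a ^ n / n.factorial) - 1))
      (Real.exp a - 1) := by
    simp only [map_sub, coeff_mk]
    exact hexp.sub (by simpa using hasSum_sum_of_ne_finset_zero h₁')
  obtain ⟨Ω, hΩ, hΩ'⟩ := exists_hasSum_log (by simp [dysonSeries, dysonTerm_zero]) hle hf hb hlt
  refine ⟨Ω, hΩ, ?_⟩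
  convert hΩ' using 1
  ext n
  have := congrArg (coeff n) (formalLog_dysonSeries hH)
  rw [formalLog, coeff_mk, coeff_mk] at this
  exact this.symm

end Convergence

end IteratedIntegral

end

theorem mainTheorem2 {A : Type*} [NormedRing A] [NormedAlgebra ℝ A] [CompleteSpace A]
    (H : ℝ → A) (t : ℝ) (ht : 0 ≤ t) (hH : ContinuousOn H (Set.Icc 0 t)) :
    -- the identity of formal series in the number of factors `H`
    IteratedIntegral.formalLog (IteratedIntegral.dysonSeries H t) =
        PowerSeries.mk (IteratedIntegral.nestedTerm H t) ∧
    -- the identity of convergent series, for the solution of `X' = X H`, `X(0) = 1`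
    (∀ X : ℝ → A, X 0 = 1 →
      (∀ s ∈ Set.Icc 0 t, HasDerivWithinAt X (X s * H s) (Set.Icc 0 t) s) →
      HasSum (IteratedIntegral.dysonTerm H t) (X t) ∧
      ((∫ s in (0 : ℝ)..t, ‖H s‖) < Real.log 2 →
        ∃ Ω : A,
          HasSum (fun k : ℕ => ((-1 : ℝ) ^ k / ((k : ℝ) + 1)) • (X t - 1) ^ (k + 1)) Ω ∧
          HasSum (IteratedIntegral.nestedTerm H t) Ω)) := by
  refine ⟨IteratedIntegral.formalLog_dysonSeries hH, fun X h₀ hX => ?_⟩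
  have hsum := IteratedIntegral.hasSum_dysonTerm ht hH h₀ hX
  exact ⟨hsum, IteratedIntegral.exists_hasSum_log_dyson ht hH hsum⟩
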